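/- Theorem 3.2. A binary or ternary string $\sigma$ determines the interval $I(\sigma)$ of all infinite sequences extending $\sigma$. Let $d:\{0,1,2\}^*\to[0,1]$ satisfy $d(\lambda)=1$ for the empty string $\lambda$ and $d(\sigma)=\sum_{i\le 2}d(\sigma^\frown i)$ for all $\sigma$, and let $\mu_d$ be the Borel measure on $\{0,1,2\}^{\mathbb N}$ with $\mu_d(I(\sigma))=d(\sigma)$ for all $\sigma$. Let $\mathcal C$ be the space of nonempty closed subsets of $2^{\mathbb N}$ with the hit-or-miss topology. For $Q\in\mathcal C$ let $T_Q=\{\sigma\in\{0,1\}^*: Q\cap I(\sigma)\ne\emptyset\}$, let $\sigma_0,\sigma_1,\dots$ enumerate $T_Q$ first by length and then lexicographically, and let the code $x_Q\in\{0,1,2\}^{\mathbb N}$ be given by $x_Q(n)=2$ if $\sigma_n{}^\frown 0$ and $\sigma_n{}^\frown 1$ are both in $T_Q$, $x_Q(n)=1$ if only $\sigma_n{}^\frown 1$ is, and $x_Q(n)=0$ if only $\sigma_n{}^\frown 0$ is. Put $\mu_d^*(\mathcal X)=\mu_d(\{x_Q:Q\in\mathcal X\})$ for Borel $\mathcal X\subseteq\mathcal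 C$, and define the capacity $T_d(Q)=\mu_d^*(\{K\in\mathcal C:K\cap Q\neq\emptyset\})$. Call $R\in\mathcal C$ $\mu_d^*$-random if $x_R$ is Martin-Löf random for $\mu_d$, that is, if $x_R\notin\bigcap_n S_n$ for every uniformly c.e. sequence $(S_n)$ of open subsets of $\{0,1,2\}^{\mathbb N}$ with $\mu_d(S_n)\le 2^{-n}$ for all $n$. Let $b<1-\frac{\sqrt2}{2}$ be fixed and suppose that $d(\sigma^\frown 0)=d(\sigma^\frown 1)\le b\cdot d(\sigma)$ for all sufficiently long $\sigma\in\{0,1,2\}^*$. Then $\{R\in\mathcal C:T_d(R)>0\}$ has $\mu_d^*$-measure one, that is, $T_d(R)>0$ for $\mu_d^*$-almost every $R\in\mathcal C$; and, furthermore, $T_d(R)>0$ for every $\mu_d^*$-random $R\in\mathcal C$. -/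

import Mathlib

open MeasureTheory TopologicalSpace
open scoped ENNReal

namespace RandomClosed

/-- The interval `I(σ)` of all infinite sequences that extend the finite string `σ`. -/
def cyl {α : Type*} (σ : List α) : Set (ℕ → α) :=
  {x | ∀ (i : ℕ) (h : i < σ.length), x i = σ[i]}

theorem mem_cyl_nil {α : Type*} (x : ℕ → α) : x ∈ cyl ([] : List α) := by
  simp [cyl]

theorem mem_cyl_append {α : Type*} (x : ℕ → α) (σ : List α) (a : α) :
    x ∈ cyl (σ ++ [a]) ↔ x ∈ cyl σ ∧ x σ.length = a := by
  constructor
  · intro h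
    refine ⟨fun i hi => ?_, ?_⟩
    · have := h i (by simp; omega)
      rwa [List.getElem_append_left hi] at this
    · have := h σ.length (by simp)
      simpa using this
  · rintro ⟨h1, h2⟩ i hi
    rcases lt_or_ge i σ.length with h | h
    · rw [List.getElem_append_left h]; exact h1 i h
    · have : i = σ.length := by simp at hi; omega
      subst this
      simpa using h2

/-! ### Measures on `{0,1,2}^ℕ` given by their values on intervals -/

/-- A function `d : {0,1,2}* → [0,1]` with `d(λ) = 1` and `d(σ) = ∑ i, d(σ⌢i)`. -/
structure MassFunction where
  /-- the underlying function on finite strings -/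
  val : List (Fin 3) → ℝ
  nonneg : ∀ σ, 0 ≤ val σ
  le_one : ∀ σ, val σ ≤ 1
  nil : val [] = 1
  split : ∀ σ, val σ = ∑ i : Fin 3, val (σ ++ [i])

instance : CoeFun MassFunction (fun _ => List (Fin 3) → ℝ) := ⟨MassFunction.val⟩

namespace Construction

variable (d : MassFunction)

/-- Left end point of the subinterval of `[0,1)` of length `d(l.reverse)` assigned to `l`. -/
noncomputable def left : List (Fin 3) → ℝ
  | [] => 0
  | i :: l => left l + (if 0 < i then d (l.reverse ++ [0]) else 0)
      + (if 1 < i then d (l.reverse ++ [1]) else 0)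

/-- The subinterval of `[0,1)` attached to `l` that contains `t` has this next digit. -/
noncomputable def digit (l : List (Fin 3)) (t : ℝ) : Fin 3 :=
  if t < left d l + d (l.reverse ++ [0]) then 0
  else if t < left d l + d (l.reverse ++ [0]) + d (l.reverse ++ [1]) then 1 else 2

/-- The first `n` digits of `t`, in reverse order. -/
noncomputable def digits (t : ℝ) : ℕ → List (Fin 3)
  | 0 => []
  | n + 1 => digit d (digits t n) t :: digits t n

/-- The digit sequence of `t`. -/
noncomputable def seq (t : ℝ) (n : ℕ) : Fin 3 := digit d (digits d t n) t

theorem seq_mem_cyl (t : ℝ) (l : List (Fin 3)) :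
    seq d t ∈ cyl l.reverse ↔ digits d t l.length = l := by
  induction l with
  | nil => simp [digits, mem_cyl_nil]
  | cons i l ih =>
    rw [List.reverse_cons, mem_cyl_append, ih]
    simp only [List.length_reverse, List.length_cons, digits, List.cons.injEq, seq]
    tauto

theorem digits_iff (l : List (Fin 3)) (t : ℝ) (ht : t ∈ Set.Ico (0 : ℝ) 1) :
    digits d t l.length = l ↔ t ∈ Set.Ico (left d l) (left d l + d l.reverse) := by
  induction l with
  | nil => simpa [digits, left, d.nil] using ht
  | cons i l ih =>
    simp only [List.length_cons, digits, List.cons.injEq, List.reverse_cons]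
    have hs := d.split l.reverse
    rw [Fin.sum_univ_three] at hs
    have h0 := d.nonneg (l.reverse ++ [0])
    have h1 := d.nonneg (l.reverse ++ [1])
    have h2 := d.nonneg (l.reverse ++ [2])
    have key : (digit d (digits d t l.length) t = i ∧ digits d t l.length = l) ↔
        (digit d l t = i ∧ t ∈ Set.Ico (left d l) (left d l + d l.reverse)) := by
      rw [← ih]
      constructor
      · rintro ⟨a, b⟩; rw [b] at a; exact ⟨a, b⟩
      · rintro ⟨a, b⟩; rw [b]; exact ⟨a, rfl⟩
    rw [key]
    simp only [digit, Set.mem_Ico, left]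
    by_cases c1 : t < left d l + d (l.reverse ++ [0])
    · rw [if_pos c1]
      fin_cases i
      · simp
        exact fun _ => ⟨fun _ => c1, fun _ => by linarith⟩
      · simp
        intro h; linarith
      · simp
        intro h; linarith
    · by_cases c2 : t < left d l + d (l.reverse ++ [0]) + d (l.reverse ++ [1])
      · rw [if_neg c1, if_pos c2]
        fin_cases i
        · simp
          intro h; linarith
        · simp
          exact ⟨fun _ => ⟨by linarith, c2⟩, fun _ => ⟨by linarith, by linarith⟩⟩
        · simp
          intro h; linarith
      · rw [if_neg c1, if_neg c2]
        fin_cases i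
        · simp
          intro h; linarith
        · simp
          intro h; linarith
        · simp
          exact ⟨fun h => ⟨by linarith, by linarith⟩, fun h => ⟨by linarith, by linarith⟩⟩

theorem left_bounds (l : List (Fin 3)) :
    0 ≤ left d l ∧ left d l + d l.reverse ≤ 1 := by
  induction l with
  | nil => simp [left, d.nil]
  | cons i l ih =>
    have hs := d.split l.reverse
    rw [Fin.sum_univ_three] at hs
    have h0 := d.nonneg (l.reverse ++ [0])
    have h1 := d.nonneg (l.reverse ++ [1])
    have h2 := d.nonneg (l.reverse ++ [2])
    rw [List.reverse_cons]
    fin_cases i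
    · simp [left]; constructor <;> linarith
    · simp [left]; constructor <;> linarith
    · simp [left]; constructor <;> linarith

theorem measurable_digit (l : List (Fin 3)) : Measurable (digit d l) :=
  Measurable.ite measurableSet_Iio measurable_const
    (Measurable.ite measurableSet_Iio measurable_const measurable_const)

theorem measurableSet_digits (n : ℕ) (l : List (Fin 3)) :
    MeasurableSet {t | digits d t n = l} := by
  induction n generalizing l with
  | zero => simp [digits]
  | succ n ih =>
    cases l with
    | nil => simp [digits]
    | cons i l =>
      have : {t | digits d t (n + 1) = i :: l} =
          {t | digits d t n = l} ∩ digit d l ⁻¹' {i} := by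
        ext t
        simp only [digits, List.cons.injEq, Set.mem_ofPred_eq, Set.mem_inter_iff,
          Set.mem_preimage, Set.mem_singleton_iff]
        constructor
        · rintro ⟨a, b⟩; rw [b] at a; exact ⟨b, a⟩
        · rintro ⟨b, a⟩; rw [b]; exact ⟨a, rfl⟩
      rw [this]
      exact (ih l).inter (measurable_digit d l (measurableSet_singleton i))

theorem measurable_seq : Measurable (seq d) := by
  refine measurable_pi_lambda _ fun n => measurable_to_countable' fun i => ?_
  have : (fun t => seq d t n) ⁻¹' {i} =
      ⋃ l : List (Fin 3), {t | digits d t n = l} ∩ digit d l ⁻¹' {i} := by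
    ext t
    simp [seq]
  rw [this]
  exact MeasurableSet.iUnion fun l =>
    (measurableSet_digits d n l).inter (measurable_digit d l (measurableSet_singleton i))

end Construction

theorem measurableSet_cyl (σ : List (Fin 3)) : MeasurableSet (cyl σ) := by
  have : cyl σ = ⋂ (i : ℕ) (h : i < σ.length), (fun x : ℕ → Fin 3 => x i) ⁻¹' {σ[i]} := by
    ext x; simp [cyl]
  rw [this]
  exact MeasurableSet.iInter fun i => MeasurableSet.iInter fun h =>
    measurable_pi_apply i (measurableSet_singleton _)

theorem exists_measure (d : MassFunction) :
    ∃ μ : Measure (ℕ → Fin 3), ∀ σ, μ (cyl σ) = ENNReal.ofReal (d σ) := by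
  refine ⟨(volume.restrict (Set.Ico (0 : ℝ) 1)).map (Construction.seq d), fun σ => ?_⟩
  rw [Measure.map_apply (Construction.measurable_seq d) (measurableSet_cyl σ),
    Measure.restrict_apply (Construction.measurable_seq d (measurableSet_cyl σ))]
  have hb := Construction.left_bounds d σ.reverse
  have : Construction.seq d ⁻¹' cyl σ ∩ Set.Ico (0 : ℝ) 1 =
      Set.Ico (Construction.left d σ.reverse) (Construction.left d σ.reverse + d σ) := by
    ext t
    have h1 := Construction.seq_mem_cyl d t σ.reverse
    rw [List.reverse_reverse] at h1 hb
    rw [Set.mem_inter_iff, Set.mem_preimage, h1]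
    constructor
    · rintro ⟨h, ht⟩
      rw [Construction.digits_iff d σ.reverse t ht, List.reverse_reverse] at h
      exact h
    · intro h
      have ht : t ∈ Set.Ico (0 : ℝ) 1 := ⟨hb.1.trans h.1, h.2.trans_le hb.2⟩
      refine ⟨?_, ht⟩
      rw [Construction.digits_iff d σ.reverse t ht, List.reverse_reverse]
      exact h
  rw [this, Real.volume_Ico]
  congr 1
  ring

/-- The Borel measure `μ_d` on `{0,1,2}^ℕ` with `μ_d(I(σ)) = d(σ)` for every string `σ`
(it is unique, because the intervals and `∅` form a π-system that generates the Borel sets). -/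
noncomputable def mu (d : MassFunction) : Measure (ℕ → Fin 3) :=
  Classical.choose (exists_measure d)

theorem mu_cyl (d : MassFunction) (σ : List (Fin 3)) :
    mu d (cyl σ) = ENNReal.ofReal (d σ) :=
  Classical.choose_spec (exists_measure d) σ

/-! ### The space of nonempty closed subsets of `2^ℕ` -/

/-- The space `𝒞` of nonempty closed subsets of `2^ℕ`. As `2^ℕ` is compact and Hausdorff, these
are its nonempty compact subsets; Mathlib's (Vietoris) topology on them is generated by the sets
`{K | K ∩ U ≠ ∅}` and `{K | K ⊆ U}` for `U` open, that is, it is the hit-or-miss topology. -/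
abbrev ClosedSets : Type := NonemptyCompacts (ℕ → Bool)

instance : MeasurableSpace ClosedSets := borel _

instance : BorelSpace ClosedSets := ⟨rfl⟩

/-- The tree `T_Q = {σ | Q ∩ I(σ) ≠ ∅}`; it has no dead ends and its set of paths is `Q`. -/
def tree (Q : ClosedSets) : Set (List Bool) :=
  {σ | ((Q : Set (ℕ → Bool)) ∩ cyl σ).Nonempty}

/-- The `k`-th binary string in the order first by length and then lexicographically (with
`false < true`): the binary expansion of `k + 1` without its leading digit. -/
def str (k : ℕ) : List Bool := (Nat.bits (k + 1)).dropLast.reverse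

theorem str_zero : str 0 = [] := by
  simp [str]

theorem str_child_false (k : ℕ) : str (2 * k + 1) = str k ++ [false] := by
  have h : Nat.bits (k + 1) ≠ [] := by
    intro h
    have := congrArg List.length h
    simp [Nat.size_eq_bits_len, Nat.size_eq_zero] at this
  have : Nat.bits (2 * k + 1 + 1) = false :: Nat.bits (k + 1) := by
    rw [show 2 * k + 1 + 1 = 2 * (k + 1) by ring, Nat.bit0_bits _ (by omega)]
  rw [str, this, List.dropLast_cons_of_ne_nil h, List.reverse_cons, str]

theorem str_child_true (k : ℕ) : str (2 * k + 2) = str k ++ [true] := by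
  have h : Nat.bits (k + 1) ≠ [] := by
    intro h
    have := congrArg List.length h
    simp [Nat.size_eq_bits_len, Nat.size_eq_zero] at this
  have : Nat.bits (2 * k + 2 + 1) = true :: Nat.bits (k + 1) := by
    rw [show 2 * k + 2 + 1 = 2 * (k + 1) + 1 by ring, Nat.bit1_bits]
  rw [str, this, List.dropLast_cons_of_ne_nil h, List.reverse_cons, str]

/-- The `n`-th element `σ_n` of `T_Q`, in the order first by length and then
lexicographically. -/
noncomputable def node (Q : ClosedSets) (n : ℕ) : List Bool :=
  str (Nat.nth (fun k => str k ∈ tree Q) n)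

open Classical in
/-- The code `x_Q ∈ {0,1,2}^ℕ` of `Q`: its `n`-th digit is `2` if both children of `σ_n` are in
`T_Q`, it is `1` if only `σ_n⌢1` is, and `0` if only `σ_n⌢0` is. -/
noncomputable def code (Q : ClosedSets) (n : ℕ) : Fin 3 :=
  if node Q n ++ [false] ∈ tree Q ∧ node Q n ++ [true] ∈ tree Q then 2
  else if node Q n ++ [true] ∈ tree Q then 1
  else 0

/-- The Borel measure `μ*_d(𝒳) = μ_d({x_Q | Q ∈ 𝒳})` on the space of nonempty closed sets
(`Q ↦ x_Q` is a homeomorphism, so images of Borel sets are Borel). -/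
noncomputable def muStar (d : MassFunction) : Measure ClosedSets :=
  (mu d).comap code

/-- The capacity `T_d(Q) = μ*_d({K | K ∩ Q ≠ ∅})`. -/
noncomputable def capacity (d : MassFunction) (Q : ClosedSets) : ℝ≥0∞ :=
  muStar d {K | ((K : Set (ℕ → Bool)) ∩ (Q : Set (ℕ → Bool))).Nonempty}

/-! ### Martin-Löf randomness -/

/-- The open set generated by a set `W` of strings. -/
def openOf (W : Set (List (Fin 3))) : Set (ℕ → Fin 3) := ⋃ σ ∈ W, cyl σ

/-- A Martin-Löf test for a measure `μ`: an effective sequence of c.e. open sets, given by a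
uniformly c.e. sequence of sets of strings, the `n`-th of measure at most `2⁻ⁿ`. -/
structure IsMLTest (μ : Measure (ℕ → Fin 3)) (W : ℕ → Set (List (Fin 3))) : Prop where
  ce : REPred fun p : ℕ × List (Fin 3) => p.2 ∈ W p.1
  measure_le : ∀ n, μ (openOf (W n)) ≤ (2⁻¹ : ℝ≥0∞) ^ n

/-- `x` is Martin-Löf random for `μ`: it lies in no set `⋂ n, S_n` for a Martin-Löf test `S`. -/
def IsMLRandom (μ : Measure (ℕ → Fin 3)) (x : ℕ → Fin 3) : Prop :=
  ∀ W : ℕ → Set (List (Fin 3)), IsMLTest μ W → x ∉ ⋂ n, openOf (W n)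

/-- A nonempty closed set is `μ*_d`-random if its code is Martin-Löf random for `μ_d`. -/
def IsRandomClosedSet (d : MassFunction) (R : ClosedSets) : Prop :=
  IsMLRandom (mu d) (code R)

end RandomClosed

/-!
A closed set `R` has positive capacity if a random closed set `K` meets it with positive
probability. The tree of `K ∩ R` grows like a branching process: if both sets keep both children
of a node with probability `1 - 2 * b` and each single child with probability `b`, a common node
has `2 * (1 - b) ^ 2` common children on average, and this exceeds `1` exactly if
`b < 1 - √2 / 2`. So `K ∩ R` survives with positive probability.

The conditional probabilities of the digits may depend on the whole history and need not be
computable, so everything is compared with the homogeneous process for one rational parameter `b`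
between the given bound and `1 - √2 / 2`. The comparison is by supermartingales on finite codes,
and Ville's inequality (`mu_openOf_le`) turns these into bounds for `μ_d`.

* A code is read as a breadth-first exploration of a tree; `queue ρ` holds the nodes that wait
  after the digits `ρ`. For a fixed tree `P`, let `treeAvoid` be the probability that the
  homogeneous tree grown from a node misses `P`. The product of `treeAvoid` over the queue of `K`
  is a supermartingale (`nextSum_queueAvoid_le`). Hence, if some node waiting after an initial
  segment of the code of `R` is avoided with probability at most `γ < 1`, at every depth, then `R`
  has positive capacity (`capacity_pos`).
* Now `R` is random. Let `r < 1` satisfy the inequality of `exists_parameters`, and give the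
  value `r` to every node that waits after the digits read so far. Evaluating backward (`vals`)
  gives estimates for the avoidance probabilities at the nodes that waited after `m` digits, and
  their product is a supermartingale, since it is affine in each value
  (`nextSum_scaledProd_vals_le`). With `r < γ < 1`, all `n` of these nodes get values at least
  `γ` with probability at most `(r / γ) ^ n`, and as the number of waiting nodes grows with `m`,
  this is exponentially small in `m` on average (`mu_openOf_vals_le`).
* The backward evaluation does not refer to `d`, and it takes place in the rationals, so these
  events form a Martin-Löf test (`exists_test`). Outside of this test `R` has positive capacity.
  The test is passed by each random `R`, and by almost every `R`.

The code is a homeomorphism (`continuous_code`, `code_injective`, `code_surjective`), so `μ*_d` is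
the image of `μ_d` under decoding (`muStar_apply`).
-/

namespace RandomClosed

/-! ### Exploring a tree from its code -/

/-- The indices of the children of `str k` that the digit `i` of a code declares present. -/
def children (k : ℕ) (i : Fin 3) : List ℕ :=
  if i = 0 then [2 * k + 1] else if i = 1 then [2 * k + 2] else [2 * k + 1, 2 * k + 2]

/-- One step of the exploration: the first waiting node is removed and its children join the end
of the queue. -/
def step : List ℕ → Fin 3 → List ℕ
  | [], _ => []
  | k :: q, i => q ++ children k i

/-- The queue of nodes (given by their indices in the enumeration `str`) that are known to lie in
the tree, but whose children are still unknown, after the digits `ρ` of the code are read. -/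
def queue (ρ : List (Fin 3)) : List ℕ := ρ.foldl step [0]

theorem queue_concat (ρ : List (Fin 3)) (i : Fin 3) :
    queue (ρ ++ [i]) = step (queue ρ) i := by
  simp [queue]

theorem mem_children {k j : ℕ} {i : Fin 3} :
    j ∈ children k i ↔ (j = 2 * k + 1 ∧ i ≠ 1) ∨ (j = 2 * k + 2 ∧ i ≠ 0) := by
  fin_cases i <;> simp [children]

/-- The queue is never empty, it is strictly increasing, and no index in it exceeds twice its
first one. -/
theorem queue_sorted (ρ : List (Fin 3)) : ∃ k q, queue ρ = k :: q ∧
    (k :: q).Pairwise (· < ·) ∧ (∀ j ∈ q, j ≤ 2 * k) ∧ ρ.length ≤ k := by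
  induction ρ using List.reverseRecOn with
  | nil => exact ⟨0, [], rfl, by simp, by simp, by simp⟩
  | append_singleton ρ i ih =>
    obtain ⟨k, q, hq, hp, hk, hl⟩ := ih
    rw [queue_concat, hq, step]
    rw [List.pairwise_cons] at hp
    cases q with
    | nil =>
      fin_cases i
      · exact ⟨2 * k + 1, [], by simp [children], by simp, by simp, by simp; omega⟩
      · exact ⟨2 * k + 2, [], by simp [children], by simp, by simp, by simp; omega⟩
      · exact ⟨2 * k + 1, [2 * k + 2], by simp [children], by simp, by simp; omega,
          by simp; omega⟩
    | cons k' q =>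
      have hkk : k < k' := hp.1 k' (by simp)
      refine ⟨k', q ++ children k i, rfl, ?_, ?_, by simp; omega⟩
      · rw [← List.cons_append, List.pairwise_append]
        refine ⟨hp.2, ?_, ?_⟩
        · fin_cases i <;> simp [children]
        · intro a ha c hc
          have := hk a ha
          rw [mem_children] at hc
          omega
      · intro j hj
        rw [List.mem_append] at hj
        rcases hj with hj | hj
        · have := hk j (by simp [hj])
          omega
        · rw [mem_children] at hj
          omega

theorem queue_mem_le (ρ : List (Fin 3)) : ∀ k ∈ queue ρ, k + 2 ≤ 2 ^ (ρ.length + 1) := by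
  induction ρ using List.reverseRecOn with
  | nil => simp [queue]
  | append_singleton ρ i ih =>
    obtain ⟨k, q, hq, -, -, -⟩ := queue_sorted ρ
    rw [queue_concat, hq, step]
    rw [hq] at ih
    intro j hj
    simp only [List.length_append, List.length_singleton]
    have h2 : 2 ^ (ρ.length + 1 + 1) = 2 * 2 ^ (ρ.length + 1) := by ring
    rw [List.mem_append] at hj
    rcases hj with hj | hj
    · have := ih j (by simp [hj])
      omega
    · rw [mem_children] at hj
      have := ih k (by simp)
      omega

/-- The first waiting node after the digits `ρ`. -/
def top (ρ : List (Fin 3)) : ℕ := (queue ρ).headI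

theorem queue_eq (ρ : List (Fin 3)) : ∃ q, queue ρ = top ρ :: q := by
  obtain ⟨k, q, hq, -⟩ := queue_sorted ρ
  exact ⟨q, by simp [top, hq]⟩

theorem top_mem (ρ : List (Fin 3)) : top ρ ∈ queue ρ := by
  obtain ⟨q, hq⟩ := queue_eq ρ
  rw [hq]; simp

theorem top_le (ρ : List (Fin 3)) : ∀ k ∈ queue ρ, top ρ ≤ k := by
  obtain ⟨k, q, hq, hp, -⟩ := queue_sorted ρ
  rw [List.pairwise_cons] at hp
  intro j hj
  rw [hq] at hj
  simp only [top, hq, List.headI_cons]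
  rcases List.mem_cons.1 hj with h | h
  · exact h.ge
  · exact (hp.1 j h).le

theorem length_le_of_mem_queue (ρ : List (Fin 3)) : ∀ k ∈ queue ρ, ρ.length ≤ k := by
  intro k hk
  obtain ⟨k', q, hq, -, -, hl⟩ := queue_sorted ρ
  have := top_le ρ k hk
  simp only [top, hq, List.headI_cons] at this
  omega

theorem mem_queue_concat (ρ : List (Fin 3)) (i : Fin 3) (k : ℕ) :
    k ∈ queue (ρ ++ [i]) ↔ (k ∈ queue ρ ∧ k ≠ top ρ) ∨ k ∈ children (top ρ) i := by
  obtain ⟨k', q, hq, hp, -, -⟩ := queue_sorted ρ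
  rw [List.pairwise_cons] at hp
  rw [queue_concat, hq, step, List.mem_append]
  simp only [top, hq, List.headI_cons, List.mem_cons]
  have : k ∈ q → k ≠ k' := fun h => (hp.1 k h).ne'
  tauto

theorem top_lt_top_concat (ρ : List (Fin 3)) (i : Fin 3) : top ρ < top (ρ ++ [i]) := by
  have h := top_mem (ρ ++ [i])
  rw [mem_queue_concat, mem_children] at h
  rcases h with h | h
  · exact lt_of_le_of_ne (top_le _ _ h.1) h.2.symm
  · omega

/-- The first `n` digits of `x`. -/
def pre {α : Type*} (x : ℕ → α) (n : ℕ) : List α := (List.range n).map x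

@[simp] theorem pre_length {α : Type*} (x : ℕ → α) (n : ℕ) : (pre x n).length = n := by
  simp [pre]

@[simp] theorem pre_zero {α : Type*} (x : ℕ → α) : pre x 0 = [] := rfl

theorem pre_succ {α : Type*} (x : ℕ → α) (n : ℕ) : pre x (n + 1) = pre x n ++ [x n] := by
  simp [pre, List.range_succ]

theorem mem_cyl_iff {α : Type*} (x : ℕ → α) (σ : List α) : x ∈ cyl σ ↔ pre x σ.length = σ := by
  constructor
  · intro h
    refine List.ext_getElem (by simp) fun i h1 h2 => ?_
    simpa [pre] using h i h2
  · intro h i hi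
    have : σ[i] = (pre x σ.length)[i]'(by simpa using hi) := by congr 1; exact h.symm
    rw [this]
    simp [pre]

theorem mem_cyl_pre {α : Type*} (x : ℕ → α) (n : ℕ) : x ∈ cyl (pre x n) := by
  simp [mem_cyl_iff]

theorem take_pre {α : Type*} (x : ℕ → α) {m n : ℕ} (h : m ≤ n) : (pre x n).take m = pre x m := by
  simp [pre, ← List.map_take, List.take_range, h]

theorem pre_eq_append {α : Type*} (x : ℕ → α) {m n : ℕ} (h : m ≤ n) :
    pre x n = pre x m ++ (pre x n).drop m := by
  rw [← take_pre x h, List.take_append_drop]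

theorem strictMono_top (x : ℕ → Fin 3) : StrictMono fun n => top (pre x n) :=
  strictMono_nat_of_lt_succ fun n => by
    rw [pre_succ]; exact top_lt_top_concat _ _

/-- Every waiting node is explored at some time. -/
theorem exists_top_of_mem_queue (x : ℕ → Fin 3) (n k : ℕ) (hk : k ∈ queue (pre x n)) :
    ∃ m, n ≤ m ∧ top (pre x m) = k := by
  by_contra! h
  have : ∀ m, n ≤ m → k ∈ queue (pre x m) := by
    intro m hm
    induction m, hm using Nat.le_induction with
    | base => exact hk
    | succ m hm ih =>
      rw [pre_succ, mem_queue_concat]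
      exact Or.inl ⟨ih, (h m hm).symm⟩
  have h1 := length_le_of_mem_queue _ _ (this (n + k + 1) (by omega))
  rw [pre_length] at h1
  omega

/-- The indices of the nodes in the tree with code `x`. -/
def explored (x : ℕ → Fin 3) : Set ℕ := Set.range fun n => top (pre x n)

theorem mem_explored_of_mem_queue {x : ℕ → Fin 3} {n k : ℕ} (hk : k ∈ queue (pre x n)) :
    k ∈ explored x := by
  obtain ⟨m, -, hm⟩ := exists_top_of_mem_queue x n k hk
  exact ⟨m, hm⟩

theorem zero_mem_explored (x : ℕ → Fin 3) : 0 ∈ explored x :=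
  mem_explored_of_mem_queue (n := 0) (by simp [queue])

theorem mem_queue_or (x : ℕ → Fin 3) (n k : ℕ) (hk : k ∈ queue (pre x n)) :
    k = 0 ∨ ∃ m, k ∈ children (top (pre x m)) (x m) := by
  induction n with
  | zero => left; simpa [queue] using hk
  | succ n ih =>
    rw [pre_succ, mem_queue_concat] at hk
    rcases hk with hk | hk
    · exact ih hk.1
    · exact Or.inr ⟨n, hk⟩

theorem mem_explored_iff (x : ℕ → Fin 3) (k : ℕ) :
    k ∈ explored x ↔ k = 0 ∨ ∃ m, k ∈ children (top (pre x m)) (x m) := by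
  constructor
  · rintro ⟨n, rfl⟩
    exact mem_queue_or x n _ (top_mem _)
  · rintro (rfl | ⟨m, hm⟩)
    · exact zero_mem_explored x
    · refine mem_explored_of_mem_queue (n := m + 1) ?_
      rw [pre_succ, mem_queue_concat]
      exact Or.inr hm

theorem left_mem_explored (x : ℕ → Fin 3) (n : ℕ) :
    2 * top (pre x n) + 1 ∈ explored x ↔ x n ≠ 1 := by
  rw [mem_explored_iff]
  simp only [mem_children]
  constructor
  · rintro (h | ⟨m, h | h⟩)
    · omega
    · have : top (pre x n) = top (pre x m) := by omega
      rw [(strictMono_top x).injective this]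
      exact h.2
    · omega
  · exact fun h => Or.inr ⟨n, Or.inl ⟨rfl, h⟩⟩

theorem right_mem_explored (x : ℕ → Fin 3) (n : ℕ) :
    2 * top (pre x n) + 2 ∈ explored x ↔ x n ≠ 0 := by
  rw [mem_explored_iff]
  simp only [mem_children]
  constructor
  · rintro (h | ⟨m, h | h⟩)
    · omega
    · omega
    · have : top (pre x n) = top (pre x m) := by omega
      rw [(strictMono_top x).injective this]
      exact h.2
  · exact fun h => Or.inr ⟨n, Or.inr ⟨rfl, h⟩⟩

/-- `P` is the set of indices of a tree without dead ends. -/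
def IsTreeSet (P : Set ℕ) : Prop :=
  0 ∈ P ∧ ∀ k, k ∈ P ↔ 2 * k + 1 ∈ P ∨ 2 * k + 2 ∈ P

theorem isTreeSet_explored (x : ℕ → Fin 3) : IsTreeSet (explored x) := by
  refine ⟨zero_mem_explored x, fun k => ⟨?_, ?_⟩⟩
  · rintro ⟨n, rfl⟩
    simp only [left_mem_explored, right_mem_explored]
    by_cases h : x n = 1
    · right; rw [h]; decide
    · exact Or.inl h
  · rw [mem_explored_iff, mem_explored_iff]
    simp only [mem_children]
    rintro ((h | ⟨m, h | h⟩) | (h | ⟨m, h | h⟩))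
    all_goals first | omega | exact ⟨m, by dsimp only; omega⟩

open Classical in
/-- The digit that describes which children of the node with index `k` lie in `P`. -/
noncomputable def childDigit (P : Set ℕ) (k : ℕ) : Fin 3 :=
  if 2 * k + 1 ∈ P ∧ 2 * k + 2 ∈ P then 2 else if 2 * k + 2 ∈ P then 1 else 0

open Classical in
theorem childDigit_congr {P P' : Set ℕ} {k : ℕ} (h1 : 2 * k + 1 ∈ P' ↔ 2 * k + 1 ∈ P)
    (h2 : 2 * k + 2 ∈ P' ↔ 2 * k + 2 ∈ P) : childDigit P' k = childDigit P k :=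
  if_congr (and_congr h1 h2) rfl (if_congr h2 rfl rfl)

theorem mem_children_childDigit {P : Set ℕ} (hP : IsTreeSet P) {k : ℕ} (hk : k ∈ P) (j : ℕ) :
    j ∈ children k (childDigit P k) ↔ j ∈ P ∧ (j = 2 * k + 1 ∨ j = 2 * k + 2) := by
  have := (hP.2 k).1 hk
  rw [mem_children]
  unfold childDigit
  by_cases h1 : 2 * k + 1 ∈ P <;> by_cases h2 : 2 * k + 2 ∈ P
  · simp [h1, h2]
    rintro (rfl | rfl) <;> assumption
  · simp [h1, h2]; constructor
    · rintro rfl; simp [h1]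
    · rintro ⟨h3, rfl | rfl⟩
      · rfl
      · exact absurd h3 h2
  · simp [h1, h2]; constructor
    · rintro rfl; simp [h2]
    · rintro ⟨h3, rfl | rfl⟩
      · exact absurd h3 h1
      · rfl
  · tauto

theorem IsTreeSet.infinite {P : Set ℕ} (hP : IsTreeSet P) : P.Infinite := by
  refine Set.infinite_of_not_bddAbove ?_
  rintro ⟨B, hB⟩
  have : ∀ n, ∃ k ∈ P, n ≤ k := by
    intro n
    induction n with
    | zero => exact ⟨0, hP.1, le_rfl⟩
    | succ n ih =>
      obtain ⟨k, hk, hn⟩ := ih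
      rcases (hP.2 k).1 hk with h | h
      · exact ⟨_, h, by omega⟩
      · exact ⟨_, h, by omega⟩
  obtain ⟨k, hk, hn⟩ := this (B + 1)
  have := hB hk
  omega

theorem IsTreeSet.parent {P : Set ℕ} (hP : IsTreeSet P) {k : ℕ} (hk : k ∈ P) (h0 : k ≠ 0) :
    (k - 1) / 2 ∈ P := by
  rw [hP.2]
  rcases Nat.even_or_odd k with h | h
  · obtain ⟨j, rfl⟩ := h
    right; rwa [show 2 * ((j + j - 1) / 2) + 2 = j + j by omega]
  · obtain ⟨j, rfl⟩ := h
    left; rwa [show 2 * ((2 * j + 1 - 1) / 2) + 1 = 2 * j + 1 by omega]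

/-- If the digits of `x` describe the nodes of `P` in increasing order, then the exploration
along `x` meets them in that order. -/
theorem mem_queue_iff {P : Set ℕ} (hP : IsTreeSet P) {a : ℕ → ℕ} (ha : StrictMono a)
    (hr : Set.range a = P) {x : ℕ → Fin 3} (hx : ∀ n, x n = childDigit P (a n)) (n : ℕ) :
    (∀ k, k ∈ queue (pre x n) ↔ k ∈ P ∧ a n ≤ k ∧ (k = 0 ∨ (k - 1) / 2 < a n)) ∧
      top (pre x n) = a n := by
  have haP : ∀ n, a n ∈ P := fun n => hr ▸ ⟨n, rfl⟩
  have key : ∀ n, (∀ k, k ∈ queue (pre x n) ↔ k ∈ P ∧ a n ≤ k ∧ (k = 0 ∨ (k - 1) / 2 < a n)) →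
      top (pre x n) = a n := by
    intro n h
    have h1 : a n ∈ queue (pre x n) := (h _).2 ⟨haP n, le_rfl, by omega⟩
    have h2 := ((h _).1 (top_mem (pre x n))).2.1
    exact le_antisymm (top_le _ _ h1) h2
  suffices h : ∀ k, k ∈ queue (pre x n) ↔ k ∈ P ∧ a n ≤ k ∧ (k = 0 ∨ (k - 1) / 2 < a n) from
    ⟨h, key n h⟩
  induction n with
  | zero =>
    have ha0 : a 0 = 0 := by
      obtain ⟨m, hm⟩ : 0 ∈ Set.range a := hr ▸ hP.1
      have := ha.monotone (Nat.zero_le m)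
      omega
    intro k
    simp [queue, ha0]
    rintro rfl; exact hP.1
  | succ n ih =>
    have ht := key n ih
    have hlt : a n < a (n + 1) := ha (Nat.lt_succ_self n)
    have gap : ∀ k ∈ P, a n < k ↔ a (n + 1) ≤ k := by
      intro k hk
      obtain ⟨m, rfl⟩ : k ∈ Set.range a := hr ▸ hk
      rw [ha.lt_iff_lt, ha.le_iff_le]
      exact Nat.lt_iff_add_one_le
    intro k
    rw [pre_succ, mem_queue_concat, ht, hx, mem_children_childDigit hP (haP n), ih]
    constructor
    · rintro (⟨⟨h1, h2, h3⟩, h4⟩ | ⟨h1, h2⟩)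
      · exact ⟨h1, (gap k h1).1 (by omega), by omega⟩
      · exact ⟨h1, (gap k h1).1 (by omega), by omega⟩
    · rintro ⟨h1, h2, h3⟩
      have h4 := (gap k h1).2 h2
      have h5 := hP.parent h1 (by omega)
      have h6 : (k - 1) / 2 ≤ a n := by
        by_contra! h
        have := (gap _ h5).1 h
        omega
      rcases h6.lt_or_eq with h | h
      · exact Or.inl ⟨⟨h1, h4.le, Or.inr h⟩, h4.ne'⟩
      · exact Or.inr ⟨h1, by omega⟩

/-! ### The code is a homeomorphism -/

theorem str_ne_nil {k : ℕ} (hk : k ≠ 0) : str k ≠ [] := by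
  rcases Nat.even_or_odd' k with ⟨j, rfl | rfl⟩
  · obtain ⟨i, rfl⟩ : ∃ i, j = i + 1 := ⟨j - 1, by omega⟩
    rw [show 2 * (i + 1) = 2 * i + 2 by ring, str_child_true]; simp
  · rw [str_child_false]; simp

theorem str_parent {k : ℕ} (hk : k ≠ 0) :
    ∃ j a, str k = str j ++ [a] ∧ k = 2 * j + (if a then 2 else 1) := by
  rcases Nat.even_or_odd' k with ⟨j, rfl | rfl⟩
  · obtain ⟨i, rfl⟩ : ∃ i, j = i + 1 := ⟨j - 1, by omega⟩
    exact ⟨i, true, by rw [show 2 * (i + 1) = 2 * i + 2 by ring, str_child_true], by simp; ring⟩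
  · exact ⟨j, false, by rw [str_child_false], by simp⟩

theorem str_injective : Function.Injective str := by
  intro k
  induction k using Nat.strong_induction_on with
  | _ k ih =>
    intro l h
    rcases eq_or_ne k 0 with rfl | hk
    · by_contra hl
      exact str_ne_nil (Ne.symm hl) (by rw [← h, str_zero])
    · rcases eq_or_ne l 0 with rfl | hl
      · exact absurd (h.trans str_zero) (str_ne_nil hk)
      · obtain ⟨i, a, h1, h2⟩ := str_parent hk
        obtain ⟨j, c, h3, h4⟩ := str_parent hl
        rw [h1, h3] at h
        obtain ⟨h5, h6⟩ := List.append_inj' h rfl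
        have hij := ih i (by rw [h2]; split <;> omega) h5
        simp only [List.cons.injEq, and_true] at h6
        rw [h2, h4, hij, h6]

theorem str_surjective : Function.Surjective str := by
  intro σ
  induction σ using List.reverseRecOn with
  | nil => exact ⟨0, str_zero⟩
  | append_singleton σ a ih =>
    obtain ⟨k, rfl⟩ := ih
    cases a
    · exact ⟨2 * k + 1, str_child_false k⟩
    · exact ⟨2 * k + 2, str_child_true k⟩

theorem lt_two_pow_length_str (k : ℕ) : k + 1 < 2 ^ ((str k).length + 1) := by
  induction k using Nat.strong_induction_on with
  | _ k ih =>
    rcases eq_or_ne k 0 with rfl | hk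
    · simp [str_zero]
    · obtain ⟨j, a, h1, h2⟩ := str_parent hk
      have := ih j (by rw [h2]; split <;> omega)
      rw [h1, List.length_append, List.length_singleton, pow_succ]
      split at h2 <;> omega

/-- The set of indices of the strings in `T_Q`. -/
def treeSet (Q : ClosedSets) : Set ℕ := {k | str k ∈ tree Q}

theorem isTreeSet_treeSet (Q : ClosedSets) : IsTreeSet (treeSet Q) := by
  constructor
  · obtain ⟨x, hx⟩ := Q.nonempty
    exact ⟨x, hx, by rw [str_zero]; exact mem_cyl_nil x⟩
  · intro k
    simp only [treeSet, Set.mem_ofPred_eq, str_child_false, str_child_true]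
    constructor
    · rintro ⟨x, hx, hk⟩
      cases h : x (str k).length
      · exact Or.inl ⟨x, hx, (mem_cyl_append _ _ _).2 ⟨hk, h⟩⟩
      · exact Or.inr ⟨x, hx, (mem_cyl_append _ _ _).2 ⟨hk, h⟩⟩
    · rintro (⟨x, hx, h⟩ | ⟨x, hx, h⟩)
      all_goals exact ⟨x, hx, ((mem_cyl_append _ _ _).1 h).1⟩

theorem code_eq_childDigit (Q : ClosedSets) (n : ℕ) :
    code Q n = childDigit (treeSet Q) (Nat.nth (· ∈ treeSet Q) n) := by
  unfold code childDigit node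
  rw [← str_child_false, ← str_child_true]
  rfl

theorem mem_queue_code (Q : ClosedSets) (n : ℕ) :
    (∀ k ∈ queue (pre (code Q) n), k ∈ treeSet Q) ∧
      top (pre (code Q) n) = Nat.nth (· ∈ treeSet Q) n := by
  have hP := isTreeSet_treeSet Q
  have h := mem_queue_iff hP (Nat.nth_strictMono hP.infinite)
    (Nat.range_nth_of_infinite hP.infinite) (code_eq_childDigit Q) n
  exact ⟨fun k hk => ((h.1 k).1 hk).1, h.2⟩

theorem code_apply (Q : ClosedSets) (n : ℕ) :
    code Q n = childDigit (treeSet Q) (top (pre (code Q) n)) := by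
  rw [(mem_queue_code Q n).2, code_eq_childDigit]

theorem explored_code (Q : ClosedSets) : explored (code Q) = treeSet Q := by
  rw [explored]
  simp_rw [(mem_queue_code Q _).2]
  exact Nat.range_nth_of_infinite (isTreeSet_treeSet Q).infinite

theorem isClopen_cyl (σ : List Bool) : IsClopen (cyl σ : Set (ℕ → Bool)) := by
  have : cyl σ = ⋂ i : Fin σ.length, (fun x : ℕ → Bool => x i) ⁻¹' {σ[i]} := by
    ext x; simp [cyl, Fin.forall_iff]
  rw [this]
  exact isClopen_iInter_of_finite fun i => (isClopen_discrete _).preimage (continuous_apply _)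

/-- A closed set is the set of paths through its tree. -/
theorem mem_iff_forall_pre_mem_tree (Q : ClosedSets) (y : ℕ → Bool) :
    y ∈ (Q : Set (ℕ → Bool)) ↔ ∀ n, pre y n ∈ tree Q := by
  constructor
  · exact fun h n => ⟨y, h, mem_cyl_pre y n⟩
  · intro h
    choose z hz hzy using h
    refine Q.isCompact.isClosed.mem_of_tendsto (f := z) (b := Filter.atTop) ?_
      (Filter.Eventually.of_forall hz)
    rw [tendsto_pi_nhds]
    intro i
    refine tendsto_const_nhds.congr' ?_
    filter_upwards [Filter.eventually_gt_atTop i] with n hn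
    have := hzy n i (by simpa using hn)
    simpa [pre] using this.symm

theorem treeSet_injective : Function.Injective treeSet := by
  intro Q Q' h
  refine NonemptyCompacts.ext (Set.ext fun y => ?_)
  rw [mem_iff_forall_pre_mem_tree, mem_iff_forall_pre_mem_tree]
  refine forall_congr' fun n => ?_
  obtain ⟨k, hk⟩ := str_surjective (pre y n)
  rw [← hk]
  exact Set.ext_iff.1 h k

theorem code_injective : Function.Injective code := by
  intro Q Q' h
  apply treeSet_injective
  rw [← explored_code, ← explored_code, h]

theorem IsTreeSet.mem_of_prefix {P : Set ℕ} (hP : IsTreeSet P) {j : ℕ} (k : ℕ) (hk : k ∈ P)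
    (h : str j <+: str k) : j ∈ P := by
  induction k using Nat.strong_induction_on with
  | _ k ih =>
    rcases eq_or_ne k 0 with rfl | h0
    · rw [str_zero, List.prefix_nil] at h
      have : j = 0 := str_injective (h.trans str_zero.symm)
      rwa [this]
    · obtain ⟨i, a, h1, h2⟩ := str_parent h0
      have hi : i ∈ P := by
        rw [hP.2]
        cases a
        · left; rw [h2] at hk; exact hk
        · right; rw [h2] at hk; exact hk
      rw [h1, List.prefix_concat_iff] at h
      rcases h with h | h
      · have : j = k := str_injective (by rw [h, h1])
        rwa [this]
      · exact ih i (by rw [h2]; split <;> omega) hi h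

/-- Above each node of a tree without dead ends there is a path. -/
theorem IsTreeSet.exists_path {P : Set ℕ} (hP : IsTreeSet P) {k : ℕ} (hk : k ∈ P) :
    ∃ y ∈ cyl (str k), ∀ j, y ∈ cyl (str j) → j ∈ P := by
  classical
  let c : ℕ → ℕ := fun i => if 2 * i + 1 ∈ P then 2 * i + 1 else 2 * i + 2
  have hcP : ∀ i ∈ P, c i ∈ P := by
    intro i hi
    dsimp only [c]
    split
    · assumption
    · exact ((hP.2 i).1 hi).resolve_left ‹_›
  have hc : ∀ i, ∃ a, str (c i) = str i ++ [a] := by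
    intro i
    dsimp only [c]
    split
    · exact ⟨false, str_child_false i⟩
    · exact ⟨true, str_child_true i⟩
  let s : ℕ → List Bool := fun n => str (c^[n] k)
  have hs : ∀ n, ∃ a, s (n + 1) = s n ++ [a] := fun n => by
    dsimp only [s]; rw [Function.iterate_succ_apply']; exact hc _
  have hlen : ∀ n, (s n).length = (str k).length + n := by
    intro n
    induction n with
    | zero => rfl
    | succ n ih =>
      obtain ⟨a, ha⟩ := hs n
      rw [ha, List.length_append, ih, List.length_singleton]; ring
  have hpre : ∀ m n, m ≤ n → s m <+: s n := by
    intro m n hmn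
    induction n, hmn using Nat.le_induction with
    | base => exact List.prefix_rfl
    | succ n _ ih =>
      obtain ⟨a, ha⟩ := hs n
      rw [ha]; exact ih.trans (List.prefix_append _ _)
  let y : ℕ → Bool := fun i => (s (i + 1)).getD i false
  have hy : ∀ n, y ∈ cyl (s n) := by
    intro n i hi
    have h1 : i < (s (i + 1)).length := by rw [hlen]; omega
    have h2 : y i = (s (i + 1))[i] := List.getD_eq_getElem _ _ h1
    rw [h2]
    rcases le_total n (i + 1) with h | h
    · exact ((hpre _ _ h).getElem hi).symm
    · exact (hpre _ _ h).getElem h1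
  have hmem : ∀ n, c^[n] k ∈ P := by
    intro n
    induction n with
    | zero => exact hk
    | succ n ih => rw [Function.iterate_succ_apply']; exact hcP _ ih
  refine ⟨y, hy 0, fun j hj => ?_⟩
  refine hP.mem_of_prefix _ (hmem (str j).length) ?_
  rw [mem_cyl_iff] at hj
  have h1 := (mem_cyl_iff _ _).1 (hy (str j).length)
  change _ <+: s _
  rw [← h1, pre_eq_append y (show (str j).length ≤ (s (str j).length).length by
    rw [hlen]; omega), hj]
  exact List.prefix_append _ _

theorem code_surjective : Function.Surjective code := by
  intro x
  have hP := isTreeSet_explored x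
  have hcl : IsClosed (⋂ j ∈ (explored x)ᶜ, (cyl (str j))ᶜ) :=
    isClosed_biInter fun j _ => (isClopen_cyl _).compl.isClosed
  have hpath : ∀ k ∈ explored x,
      ((⋂ j ∈ (explored x)ᶜ, (cyl (str j))ᶜ) ∩ cyl (str k)).Nonempty := by
    intro k hk
    obtain ⟨y, hy, hj⟩ := hP.exists_path hk
    refine ⟨y, ?_, hy⟩
    simp only [Set.mem_iInter, Set.mem_compl_iff]
    exact fun j h1 h2 => h1 (hj j h2)
  let Q : ClosedSets := ⟨⟨_, hcl.isCompact⟩, (hpath 0 hP.1).mono Set.inter_subset_left⟩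
  have hQ : treeSet Q = explored x := by
    ext k
    constructor
    · rintro ⟨y, hy, hyk⟩
      by_contra hk
      exact Set.mem_iInter₂.1 hy k hk hyk
    · exact hpath k
  have hnth : Nat.nth (· ∈ treeSet Q) = fun n => top (pre x n) := by
    refine ((Nat.nth_strictMono (isTreeSet_treeSet Q).infinite).range_inj (strictMono_top x)).1 ?_
    rw [Nat.range_nth_of_infinite (isTreeSet_treeSet Q).infinite]
    exact hQ
  refine ⟨Q, funext fun n => ?_⟩
  rw [code_eq_childDigit, hnth, hQ, childDigit]
  simp only [left_mem_explored, right_mem_explored]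
  generalize x n = i
  fin_cases i <;> simp

theorem isClopen_setOf_mem_treeSet (k : ℕ) : IsClopen {Q : ClosedSets | k ∈ treeSet Q} :=
  ⟨NonemptyCompacts.isClosed_inter_nonempty_of_isClosed (isClopen_cyl _).isClosed,
    NonemptyCompacts.isOpen_inter_nonempty_of_isOpen (isClopen_cyl _).isOpen⟩

theorem continuous_code : Continuous code := by
  have hk : ∀ (Q : ClosedSets) (k : ℕ), ∀ᶠ Q' in nhds Q, (k ∈ treeSet Q' ↔ k ∈ treeSet Q) := by
    intro Q k
    by_cases h : k ∈ treeSet Q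
    · filter_upwards [(isClopen_setOf_mem_treeSet k).isOpen.mem_nhds h] with Q' h'
      exact iff_of_true h' h
    · filter_upwards [(isClopen_setOf_mem_treeSet k).compl.isOpen.mem_nhds h] with Q' h'
      exact iff_of_false h' h
  have hn : ∀ (Q : ClosedSets) (n : ℕ), ∀ᶠ Q' in nhds Q, pre (code Q') n = pre (code Q) n := by
    intro Q n
    induction n with
    | zero => simp
    | succ n ih =>
      filter_upwards [ih, hk Q (2 * top (pre (code Q) n) + 1),
        hk Q (2 * top (pre (code Q) n) + 2)] with Q' h1 h2 h3
      rw [pre_succ, pre_succ, code_apply, code_apply, h1]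
      rw [childDigit_congr h2 h3]
  refine continuous_pi fun n => continuous_iff_continuousAt.2 fun Q => ?_
  refine tendsto_const_nhds.congr' ?_
  filter_upwards [hn Q (n + 1)] with Q' h
  rw [pre_succ, pre_succ] at h
  simpa using (List.append_inj' h rfl).2.symm

theorem measurableEmbedding_code : MeasurableEmbedding code :=
  (continuous_code.isClosedEmbedding code_injective).measurableEmbedding

theorem muStar_apply (d : MassFunction) (s : Set ClosedSets) :
    muStar d s = mu d (code '' s) :=
  measurableEmbedding_code.comap_apply _ _

/-- Two closed sets meet if their trees have arbitrarily long strings in common. -/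
theorem inter_nonempty_of_treeSet (K R : ClosedSets)
    (h : ∀ n, ∃ k, n ≤ k ∧ k ∈ treeSet K ∧ k ∈ treeSet R) :
    ((K : Set (ℕ → Bool)) ∩ (R : Set (ℕ → Bool))).Nonempty := by
  let D : ℕ → Set ((ℕ → Bool) × (ℕ → Bool)) := fun n =>
    ((K : Set (ℕ → Bool)) ×ˢ (R : Set (ℕ → Bool))) ∩ ⋂ i ∈ Finset.range n, {p | p.1 i = p.2 i}
  have hcl : ∀ n, IsClosed (⋂ i ∈ Finset.range n,
      {p : (ℕ → Bool) × (ℕ → Bool) | p.1 i = p.2 i}) := fun n =>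
    isClosed_biInter fun i _ => isClosed_eq ((continuous_apply i).comp continuous_fst)
      ((continuous_apply i).comp continuous_snd)
  have hKR := K.isCompact.prod R.isCompact
  obtain ⟨⟨y, z⟩, hyz⟩ : (⋂ n, D n).Nonempty := by
    refine IsCompact.nonempty_iInter_of_sequence_nonempty_isCompact_isClosed D ?_ ?_ ?_ ?_
    · intro n p hp
      refine ⟨hp.1, ?_⟩
      have := hp.2
      simp only [Set.mem_iInter, Finset.mem_range] at this ⊢
      exact fun i hi => this i (by omega)
    · intro n
      obtain ⟨k, hk, ⟨y, hy, hyk⟩, ⟨z, hz, hzk⟩⟩ := h (2 ^ (n + 1))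
      refine ⟨(y, z), ⟨hy, hz⟩, ?_⟩
      simp only [Set.mem_iInter, Finset.mem_range]
      intro i hi
      have h1 := lt_two_pow_length_str k
      have h2 : 2 ^ (n + 1) < 2 ^ ((str k).length + 1) := by omega
      have h3 := (Nat.pow_lt_pow_iff_right (by norm_num)).1 h2
      exact (hyk i (by omega)).trans (hzk i (by omega)).symm
    · exact hKR.inter_right (hcl 0)
    · exact fun n => hKR.isClosed.inter (hcl n)
  have h0 := Set.mem_iInter.1 hyz 0
  have : y = z := by
    funext i
    have h1 := (Set.mem_iInter.1 hyz (i + 1)).2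
    simp only [Set.mem_iInter, Finset.mem_range] at h1
    exact h1 i (by omega)
  refine ⟨y, h0.1.1, ?_⟩
  rw [this]; exact h0.1.2

/-! ### A maximal inequality on strings -/

theorem mu_univ (d : MassFunction) : mu d Set.univ = 1 := by
  have h : cyl ([] : List (Fin 3)) = Set.univ := Set.eq_univ_of_forall mem_cyl_nil
  rw [← h, mu_cyl, d.nil, ENNReal.ofReal_one]

/-- The weighted sum over the possible next digits, which is `d σ` times the conditional
expectation of `M` after one more digit. -/
def nextSum (d : MassFunction) (M : List (Fin 3) → ℝ) (σ : List (Fin 3)) : ℝ :=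
  d (σ ++ [0]) * M (σ ++ [0]) + d (σ ++ [1]) * M (σ ++ [1]) + d (σ ++ [2]) * M (σ ++ [2])

theorem cyl_append_subset (σ δ : List (Fin 3)) :
    (cyl (σ ++ δ) : Set (ℕ → Fin 3)) ⊆ cyl σ := by
  intro x hx i hi
  have := hx i (by rw [List.length_append]; omega)
  rwa [List.getElem_append_left hi] at this

/-- **Ville's maximal inequality** over finitely many steps: a nonnegative supermartingale that
has the value `M σ` at `σ` reaches `1` with conditional probability at most `M σ`. -/
theorem mu_reach_le_of_steps (d : MassFunction) (M : List (Fin 3) → ℝ) (hM : ∀ ρ, 0 ≤ M ρ)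
    (S : Set (List (Fin 3))) (n : ℕ) : ∀ σ : List (Fin 3),
    (∀ δ, δ.length < n → nextSum d M (σ ++ δ) ≤ d (σ ++ δ) * M (σ ++ δ)) →
    (∀ δ, σ ++ δ ∈ S → 1 ≤ M (σ ++ δ)) →
    mu d (⋃ δ ∈ {δ : List (Fin 3) | δ.length ≤ n ∧ σ ++ δ ∈ S}, cyl (σ ++ δ)) ≤
      ENNReal.ofReal (d σ * M σ) := by
  induction n with
  | zero =>
    intro σ _ hS
    by_cases h : σ ∈ S
    · calc _ ≤ mu d (cyl σ) :=
            measure_mono (Set.iUnion₂_subset fun δ _ => cyl_append_subset σ δ)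
        _ ≤ _ := by
          rw [mu_cyl]
          refine ENNReal.ofReal_le_ofReal (le_mul_of_one_le_right (d.nonneg σ) ?_)
          simpa using hS [] (by simpa using h)
    · have : {δ : List (Fin 3) | δ.length ≤ 0 ∧ σ ++ δ ∈ S} = ∅ := by
        ext δ
        simp only [Nat.le_zero, List.length_eq_zero_iff, Set.mem_ofPred_eq, Set.mem_empty_iff_false,
          iff_false, not_and]
        rintro rfl
        simpa using h
      rw [this]; simp
  | succ n ih =>
    intro σ hsup hS
    by_cases h : σ ∈ S
    · calc _ ≤ mu d (cyl σ) :=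
            measure_mono (Set.iUnion₂_subset fun δ _ => cyl_append_subset σ δ)
        _ ≤ _ := by
          rw [mu_cyl]
          refine ENNReal.ofReal_le_ofReal (le_mul_of_one_le_right (d.nonneg σ) ?_)
          simpa using hS [] (by simpa using h)
    · have hi : ∀ i : Fin 3, mu d (⋃ δ ∈ {δ : List (Fin 3) | δ.length ≤ n ∧ σ ++ [i] ++ δ ∈ S},
          cyl (σ ++ [i] ++ δ)) ≤ ENNReal.ofReal (d (σ ++ [i]) * M (σ ++ [i])) := by
        intro i
        refine ih (σ ++ [i]) (fun δ hδ => ?_) (fun δ hδ => ?_)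
        · have := hsup (i :: δ) (by simpa using hδ)
          simpa using this
        · have := hS (i :: δ) (by simpa using hδ)
          simpa using this
      calc _ ≤ mu d (⋃ i : Fin 3, ⋃ δ ∈ {δ : List (Fin 3) | δ.length ≤ n ∧ σ ++ [i] ++ δ ∈ S},
            cyl (σ ++ [i] ++ δ)) := by
            refine measure_mono (Set.iUnion₂_subset fun δ hδ => ?_)
            obtain ⟨h1, h2⟩ := hδ
            cases δ with
            | nil => exact absurd (by simpa using h2) h
            | cons i δ =>
              refine Set.subset_iUnion_of_subset i (Set.subset_iUnion₂_of_subset δ ?_ ?_)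
              · exact ⟨by simpa using h1, by simpa using h2⟩
              · simp
        _ ≤ ∑ i : Fin 3, ENNReal.ofReal (d (σ ++ [i]) * M (σ ++ [i])) :=
          (measure_iUnion_fintype_le _ _).trans (Finset.sum_le_sum fun i _ => hi i)
        _ = ENNReal.ofReal (nextSum d M σ) := by
          rw [← ENNReal.ofReal_sum_of_nonneg fun i _ => mul_nonneg (d.nonneg _) (hM _),
            Fin.sum_univ_three]
          rfl
        _ ≤ _ := by
          refine ENNReal.ofReal_le_ofReal ?_
          simpa using hsup [] (by simp)

/-- Ville's maximal inequality for the open set generated by `S`. -/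
theorem mu_openOf_le (d : MassFunction) (M : List (Fin 3) → ℝ) (hM : ∀ ρ, 0 ≤ M ρ)
    (S : Set (List (Fin 3))) (hsup : ∀ ρ, nextSum d M ρ ≤ d ρ * M ρ) (hS : ∀ ρ ∈ S, 1 ≤ M ρ) :
    mu d (openOf S) ≤ ENNReal.ofReal (M []) := by
  have hU : openOf S =
      ⋃ n : ℕ, ⋃ δ ∈ {δ : List (Fin 3) | δ.length ≤ n ∧ [] ++ δ ∈ S}, cyl ([] ++ δ) := by
    ext x
    simp only [openOf, Set.mem_iUnion, Set.mem_ofPred_eq, List.nil_append, exists_prop]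
    constructor
    · rintro ⟨δ, h1, h2⟩
      exact ⟨δ.length, δ, ⟨le_rfl, h1⟩, h2⟩
    · rintro ⟨n, δ, ⟨-, h1⟩, h2⟩
      exact ⟨δ, h1, h2⟩
  have hmono : Monotone fun n : ℕ =>
      ⋃ δ ∈ {δ : List (Fin 3) | δ.length ≤ n ∧ [] ++ δ ∈ S}, (cyl ([] ++ δ) : Set (ℕ → Fin 3)) :=
    fun m n hmn => Set.biUnion_mono (fun δ hδ => ⟨hδ.1.trans hmn, hδ.2⟩) fun _ _ => subset_rfl
  rw [hU, hmono.measure_iUnion]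
  refine iSup_le fun n => ?_
  have := mu_reach_le_of_steps d M hM S n [] (fun δ _ => hsup _) (fun δ h => hS _ h)
  rwa [d.nil, one_mul] at this

/-! ### The failure probability of a branching step -/

/-- If the children of a node are avoided with probabilities `x` and `y`, then `avoid b x y` is
the probability that the node is avoided by a random tree that keeps only one given child with
probability `b` for each of the children, and both with probability `1 - 2 * b`. -/
def avoid (b x y : ℝ) : ℝ := b * x + b * y + (1 - 2 * b) * x * y

section avoid

variable {b x y x' y' : ℝ}

theorem avoid_comm (b x y : ℝ) : avoid b x y = avoid b y x := by
  unfold avoid; ring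

theorem avoid_one_one (b : ℝ) : avoid b 1 1 = 1 := by
  unfold avoid; ring

theorem avoid_nonneg (hb : 0 ≤ b) (hb2 : 2 * b ≤ 1) (hx : 0 ≤ x) (hy : 0 ≤ y) :
    0 ≤ avoid b x y := by
  unfold avoid
  have : 0 ≤ 1 - 2 * b := by linarith
  positivity

theorem avoid_mono (hb : 0 ≤ b) (hb2 : 2 * b ≤ 1) (hx : 0 ≤ x) (hy : 0 ≤ y) (hxx : x ≤ x')
    (hyy : y ≤ y') : avoid b x y ≤ avoid b x' y' := by
  unfold avoid
  have h : 0 ≤ 1 - 2 * b := by linarith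
  have := mul_le_mul hxx hyy hy (hx.trans hxx)
  nlinarith

theorem avoid_le_one (hb : 0 ≤ b) (hb2 : 2 * b ≤ 1) (hx : 0 ≤ x) (hy : 0 ≤ y) (hx1 : x ≤ 1)
    (hy1 : y ≤ 1) : avoid b x y ≤ 1 :=
  (avoid_mono hb hb2 hx hy hx1 hy1).trans (avoid_one_one b).le

/-- If the single children are kept with the unnormalized weight `p ≤ b * D` instead of `b * D`,
out of a total weight `D`, then the node is avoided with at most the same weight. -/
theorem weighted_le_avoid (hx : 0 ≤ x) (hy : 0 ≤ y) (hx1 : x ≤ 1) (hy1 : y ≤ 1) {p D : ℝ}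
    (hp : p ≤ b * D) : p * x + p * y + (D - 2 * p) * (x * y) ≤ D * avoid b x y := by
  unfold avoid
  nlinarith [mul_nonneg (sub_nonneg.2 hp) (add_nonneg (mul_nonneg hx (sub_nonneg.2 hy1))
    (mul_nonneg hy (sub_nonneg.2 hx1)))]

end avoid

/-- Below the critical value `1 - √2 / 2` there are a rational parameter `c > b` and a rational
`r < 1` with the following property: if each child of a node in the random set `R` is avoided by
the random tree with probability `r`, then the node, with its children in `R` chosen at random, is
avoided with mean probability at most `r`. -/
theorem exists_parameters {b : ℝ} (hb : b < 1 - √2 / 2) : ∃ c r : ℚ, b < c ∧ 0 < c ∧ 2 * c < 1 ∧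
    0 < r ∧ r < 1 ∧
    2 * (c : ℝ) * avoid c r 1 + (1 - 2 * (c : ℝ)) * avoid c r r ≤ r := by
  have h2 : √2 ^ 2 = 2 := Real.sq_sqrt (by norm_num)
  have h1 : 1 < √2 := by rw [Real.lt_sqrt] <;> norm_num
  have h3 : √2 < 2 := by rw [Real.sqrt_lt'] <;> norm_num
  obtain ⟨c, hc1, hc2⟩ := exists_rat_btwn (show max b 0 < 1 - √2 / 2 from
    max_lt hb (by linarith))
  have hbc : b < c := (le_max_left _ _).trans_lt hc1
  have hc0 : (0 : ℝ) < c := (le_max_right _ _).trans_lt hc1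
  have hc3 : (c : ℝ) * √2 < 1 - 2 * c := by nlinarith
  have hc4 : 0 < 1 - 2 * (c : ℝ) := lt_trans (by positivity) hc3
  have hc5 : 2 * (c : ℝ) ^ 2 < (1 - 2 * c) ^ 2 := by
    have := mul_self_lt_mul_self (by positivity) hc3
    nlinarith
  have hq : 2 * (c : ℝ) ^ 2 / (1 - 2 * c) ^ 2 < 1 := (div_lt_one (by positivity)).2 hc5
  obtain ⟨r, hr1, hr2⟩ := exists_rat_btwn hq
  have hr0 : (0 : ℝ) < r := lt_of_le_of_lt (by positivity) hr1
  rw [div_lt_iff₀ (by positivity)] at hr1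
  refine ⟨c, r, hbc, by exact_mod_cast hc0, by exact_mod_cast (by linarith : 2 * (c : ℝ) < 1),
    by exact_mod_cast hr0, by exact_mod_cast hr2, ?_⟩
  -- The difference of the two sides is `(r - 1) * (r * (1 - 2 * c) ^ 2 - 2 * c ^ 2)`.
  have := mul_nonneg (sub_nonneg.2 hr2.le) (sub_nonneg.2 hr1.le)
  unfold avoid
  nlinarith

/-! ### Backward evaluation along a code -/

/-- Values at the nodes of a queue, with the last node first, are turned into values at the nodes
of the queue one step earlier: the last one or two of them belong to the children of the first
node of the earlier queue, which gets the combined value `f x y`. An absent child has the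
value `e`. -/
def back {α : Type*} (f : α → α → α) (e : α) (i : Fin 3) (l : List α) : List α :=
  if i = 2 then
    match l with
    | x :: y :: l => l ++ [f y x]
    | l => l
  else
    match l with
    | x :: l => l ++ [f x e]
    | [] => []

theorem map_back {α β : Type*} {f : α → α → α} {e : α} {f' : β → β → β} {e' : β} {φ : α → β}
    (hf : ∀ x y, φ (f x y) = f' (φ x) (φ y)) (he : φ e = e') (i : Fin 3) (l : List α) :
    (back f e i l).map φ = back f' e' i (l.map φ) := by
  unfold back
  split
  · match l with
    | [] => rfl
    | [x] => rfl
    | x :: y :: l => simp [hf]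
  · match l with
    | [] => rfl
    | x :: l => simp [hf, he]

/-- The values at the nodes that wait after the first `m` digits of `ρ`, computed by backward
evaluation from the value `r` at each node that waits after all of `ρ`. -/
def vals {α : Type*} (f : α → α → α) (e r : α) (m : ℕ) (ρ : List (Fin 3)) : List α :=
  (ρ.drop m).foldr (back f e) (List.replicate (queue ρ).length r)

theorem map_vals {α β : Type*} {f : α → α → α} {e r : α} {f' : β → β → β} {e' r' : β}
    {φ : α → β} (hf : ∀ x y, φ (f x y) = f' (φ x) (φ y)) (he : φ e = e') (hr : φ r = r')
    (m : ℕ) (ρ : List (Fin 3)) : (vals f e r m ρ).map φ = vals f' e' r' m ρ := by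
  unfold vals
  generalize (queue ρ).length = n
  induction ρ.drop m with
  | nil => simp [hr]
  | cons i δ ih => rw [List.foldr_cons, List.foldr_cons, map_back hf he, ih]

theorem length_queue_concat (ρ : List (Fin 3)) (i : Fin 3) :
    (queue (ρ ++ [i])).length = (queue ρ).length + if i = 2 then 1 else 0 := by
  obtain ⟨q, hq⟩ := queue_eq ρ
  rw [queue_concat, hq, step]
  fin_cases i <;> simp [children]

theorem exists_length_queue (ρ : List (Fin 3)) : ∃ n, (queue ρ).length = n + 1 := by
  obtain ⟨q, hq⟩ := queue_eq ρ
  exact ⟨q.length, by rw [hq]; rfl⟩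

/-- A function of finitely many nonnegative numbers that is affine and nondecreasing in each of
them. -/
def IsMultiAffine (Ψ : List ℝ → ℝ) : Prop :=
  ∀ l₁ l₂ : List ℝ, (∀ x ∈ l₁, 0 ≤ x) → (∀ x ∈ l₂, 0 ≤ x) →
    ∃ A B, 0 ≤ B ∧ ∀ v, 0 ≤ v → Ψ (l₁ ++ v :: l₂) = A + B * v

/-- Backward evaluation preserves multi-affine functions. -/
theorem IsMultiAffine.comp_back {Ψ : List ℝ → ℝ} (h : IsMultiAffine Ψ) {b : ℝ} (hb : 0 ≤ b)
    (hb2 : 2 * b ≤ 1) (i : Fin 3) : IsMultiAffine fun l => Ψ (back (avoid b) 1 i l) := by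
  have hb3 : 0 ≤ 1 - 2 * b := by linarith
  intro l₁ l₂ h₁ h₂
  by_cases hi : i = 2
  · simp only [back, if_pos hi]
    match l₁, l₂ with
    | [], [] => exact h [] [] (by simp) (by simp)
    | [], y :: l =>
      have hy : 0 ≤ y := h₂ y (by simp)
      obtain ⟨A, B, hB, hAB⟩ := h l [] (fun x hx => h₂ x (by simp [hx])) (by simp)
      refine ⟨A + B * (b * y), B * (b + (1 - 2 * b) * y), by positivity, fun v hv => ?_⟩
      have := hAB _ (avoid_nonneg hb hb2 hy hv)
      simp only [List.nil_append]
      rw [this, avoid]; ring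
    | [x], l =>
      have hx : 0 ≤ x := h₁ x (by simp)
      obtain ⟨A, B, hB, hAB⟩ := h l [] h₂ (by simp)
      refine ⟨A + B * (b * x), B * (b + (1 - 2 * b) * x), by positivity, fun v hv => ?_⟩
      have := hAB _ (avoid_nonneg hb hb2 hv hx)
      simp only [List.singleton_append]
      rw [this, avoid]; ring
    | x :: y :: l, l' =>
      have hxy := avoid_nonneg hb hb2 (h₁ y (by simp)) (h₁ x (by simp))
      obtain ⟨A, B, hB, hAB⟩ := h l (l' ++ [avoid b y x])
        (fun z hz => h₁ z (by simp [hz])) (by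
          intro z hz
          rcases List.mem_append.1 hz with hz | hz
          · exact h₂ z hz
          · rw [List.mem_singleton.1 hz]; exact hxy)
      refine ⟨A, B, hB, fun v hv => ?_⟩
      simpa using hAB v hv
  · simp only [back, if_neg hi]
    match l₁, l₂ with
    | [], l =>
      obtain ⟨A, B, hB, hAB⟩ := h l [] h₂ (by simp)
      refine ⟨A + B * b, B * (b + (1 - 2 * b)), by positivity, fun v hv => ?_⟩
      have := hAB _ (avoid_nonneg hb hb2 hv zero_le_one)
      simp only [List.nil_append]
      rw [this, avoid]; ring
    | x :: l, l' =>
      have hx := avoid_nonneg hb hb2 (h₁ x (by simp)) zero_le_one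
      obtain ⟨A, B, hB, hAB⟩ := h l (l' ++ [avoid b x 1])
        (fun z hz => h₁ z (by simp [hz])) (by
          intro z hz
          rcases List.mem_append.1 hz with hz | hz
          · exact h₂ z hz
          · rw [List.mem_singleton.1 hz]; exact hx)
      refine ⟨A, B, hB, fun v hv => ?_⟩
      simpa using hAB v hv

theorem IsMultiAffine.comp_foldr_back {Ψ : List ℝ → ℝ} (h : IsMultiAffine Ψ) {b : ℝ}
    (hb : 0 ≤ b) (hb2 : 2 * b ≤ 1) (δ : List (Fin 3)) :
    IsMultiAffine fun l => Ψ (δ.foldr (back (avoid b) 1) l) := by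
  induction δ using List.reverseRecOn with
  | nil => exact h
  | append_singleton δ i ih =>
    simp only [List.foldr_append]
    exact ih.comp_back hb hb2 i

/-- The product of all numbers divided by `γ`. -/
noncomputable def scaledProd (γ : ℝ) (l : List ℝ) : ℝ := (l.map (· / γ)).prod

theorem scaledProd_append (γ : ℝ) (l l' : List ℝ) :
    scaledProd γ (l ++ l') = scaledProd γ l * scaledProd γ l' := by
  simp [scaledProd]

theorem scaledProd_cons (γ v : ℝ) (l : List ℝ) :
    scaledProd γ (v :: l) = v / γ * scaledProd γ l := by
  simp [scaledProd]

theorem scaledProd_nonneg {γ : ℝ} (hγ : 0 < γ) {l : List ℝ} (hl : ∀ x ∈ l, 0 ≤ x) :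
    0 ≤ scaledProd γ l := by
  refine List.prod_nonneg fun x hx => ?_
  obtain ⟨y, hy, rfl⟩ := List.mem_map.1 hx
  exact div_nonneg (hl y hy) hγ.le

theorem one_le_scaledProd {γ : ℝ} (hγ : 0 < γ) {l : List ℝ} (hl : ∀ x ∈ l, γ ≤ x) :
    1 ≤ scaledProd γ l := by
  induction l with
  | nil => simp [scaledProd]
  | cons x l ih =>
    rw [scaledProd_cons]
    have h1 : 1 ≤ x / γ := (one_le_div hγ).2 (hl x (by simp))
    have h2 := ih fun y hy => hl y (by simp [hy])
    nlinarith

theorem isMultiAffine_scaledProd {γ : ℝ} (hγ : 0 < γ) : IsMultiAffine (scaledProd γ) := by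
  intro l₁ l₂ h₁ h₂
  refine ⟨0, scaledProd γ l₁ * scaledProd γ l₂ / γ,
    div_nonneg (mul_nonneg (scaledProd_nonneg hγ h₁) (scaledProd_nonneg hγ h₂)) hγ.le,
    fun v _ => ?_⟩
  rw [scaledProd_append, scaledProd_cons]; ring

theorem vals_mem {b r : ℝ} (hb : 0 ≤ b) (hb2 : 2 * b ≤ 1) (hr : 0 ≤ r) (hr1 : r ≤ 1) (m : ℕ)
    (ρ : List (Fin 3)) : ∀ x ∈ vals (avoid b) 1 r m ρ, 0 ≤ x ∧ x ≤ 1 := by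
  unfold vals
  generalize (queue ρ).length = n
  induction ρ.drop m with
  | nil =>
    intro x hx
    rw [List.foldr_nil] at hx
    rw [List.eq_of_mem_replicate hx]
    exact ⟨hr, hr1⟩
  | cons i δ ih =>
    rw [List.foldr_cons]
    generalize δ.foldr (back (avoid b) 1) (List.replicate n r) = l at ih
    have key : ∀ y z : ℝ, (0 ≤ y ∧ y ≤ 1) → (0 ≤ z ∧ z ≤ 1) →
        0 ≤ avoid b y z ∧ avoid b y z ≤ 1 := fun y z hy hz =>
      ⟨avoid_nonneg hb hb2 hy.1 hz.1, avoid_le_one hb hb2 hy.1 hz.1 hy.2 hz.2⟩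
    intro x hx
    unfold back at hx
    split at hx
    · match l with
      | [] => simp at hx
      | [y] => exact ih x hx
      | y :: z :: l =>
        rcases List.mem_append.1 hx with hx | hx
        · exact ih x (by simp [hx])
        · rw [List.mem_singleton.1 hx]
          exact key _ _ (ih z (by simp)) (ih y (by simp))
    · match l with
      | [] => simp at hx
      | y :: l =>
        rcases List.mem_append.1 hx with hx | hx
        · exact ih x (by simp [hx])
        · rw [List.mem_singleton.1 hx]
          exact key _ _ (ih y (by simp)) ⟨zero_le_one, le_rfl⟩

/-! ### The measure of the test sets -/

/-- From length `N` on, the digits `0` and `1`, which stand for a single child, have equal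
conditional probabilities, of at most `b`. -/
def EventuallyBalanced (d : MassFunction) (b : ℝ) (N : ℕ) : Prop :=
  ∀ σ : List (Fin 3), N ≤ σ.length → d (σ ++ [0]) = d (σ ++ [1]) ∧ d (σ ++ [0]) ≤ b * d σ

/-- Beyond length `m`, extending `ρ` by a random digit does not increase the expected scaled
product of the values at the nodes waiting after `m` digits, if the leaf value `r` satisfies the
inequality `hfix`. -/
theorem nextSum_scaledProd_vals_le {d : MassFunction} {b r γ : ℝ} (hb : 0 ≤ b) (hb2 : 2 * b ≤ 1)
    (hr : 0 ≤ r) (hr1 : r ≤ 1)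
    (hfix : 2 * b * avoid b r 1 + (1 - 2 * b) * avoid b r r ≤ r) (hγ : 0 < γ)
    {N m : ℕ} (hd : EventuallyBalanced d b N) (ρ : List (Fin 3)) (hN : N ≤ ρ.length)
    (hm : m ≤ ρ.length) :
    nextSum d (fun ρ => scaledProd γ (vals (avoid b) 1 r m ρ)) ρ ≤
      d ρ * scaledProd γ (vals (avoid b) 1 r m ρ) := by
  obtain ⟨n, hn⟩ := exists_length_queue ρ
  obtain ⟨A, B, hB, hAB⟩ :=
    (isMultiAffine_scaledProd hγ).comp_foldr_back hb hb2 (ρ.drop m) (List.replicate n r) []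
      (fun x hx => by rw [List.eq_of_mem_replicate hx]; exact hr) (by simp)
  -- After the digit `i` the list of leaf values, evaluated back by one step, differs from the one
  -- before it only in the last entry, which belongs to the node explored by `i`.
  have hval : ∀ i v, back (avoid b) 1 i (List.replicate (queue (ρ ++ [i])).length r) =
      List.replicate n r ++ [v] → 0 ≤ v →
      scaledProd γ (vals (avoid b) 1 r m (ρ ++ [i])) = A + B * v := by
    intro i v h hv
    rw [vals, List.drop_append_of_le_length hm, List.foldr_append, List.foldr_cons,
      List.foldr_nil, h]
    exact hAB v hv
  have h0 : scaledProd γ (vals (avoid b) 1 r m (ρ ++ [0])) = A + B * avoid b r 1 := by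
    refine hval 0 _ ?_ (avoid_nonneg hb hb2 hr zero_le_one)
    rw [length_queue_concat, hn]
    simp [back, List.replicate_succ]
  have h1 : scaledProd γ (vals (avoid b) 1 r m (ρ ++ [1])) = A + B * avoid b r 1 := by
    refine hval 1 _ ?_ (avoid_nonneg hb hb2 hr zero_le_one)
    rw [length_queue_concat, hn]
    simp [back, List.replicate_succ]
  have h2 : scaledProd γ (vals (avoid b) 1 r m (ρ ++ [2])) = A + B * avoid b r r := by
    refine hval 2 _ ?_ (avoid_nonneg hb hb2 hr hr)
    rw [length_queue_concat, hn]
    simp [back, List.replicate_succ]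
  have h3 : scaledProd γ (vals (avoid b) 1 r m ρ) = A + B * r := by
    rw [vals, hn, List.replicate_succ']
    exact hAB r hr
  obtain ⟨hp, hpb⟩ := hd ρ hN
  have hs := d.split ρ
  rw [Fin.sum_univ_three] at hs
  have hmono : avoid b r r ≤ avoid b r 1 := avoid_mono hb hb2 hr hr le_rfl hr1
  have hd0 := d.nonneg ρ
  unfold nextSum
  simp only [h0, h1, h2, h3]
  rw [← hp] at hs ⊢
  rw [show d (ρ ++ [2]) = d ρ - 2 * d (ρ ++ [0]) by linarith]
  have key : 2 * d (ρ ++ [0]) * avoid b r 1 + (d ρ - 2 * d (ρ ++ [0])) * avoid b r r ≤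
      d ρ * r := by
    nlinarith [mul_nonneg (sub_nonneg.2 hpb) (sub_nonneg.2 hmono),
      mul_nonneg hd0 (sub_nonneg.2 hfix)]
  nlinarith [mul_nonneg hB (sub_nonneg.2 key)]

theorem scaledProd_vals_of_length_le {f : ℝ → ℝ → ℝ} {e r γ : ℝ} {m : ℕ} {ρ : List (Fin 3)}
    (hm : ρ.length ≤ m) : scaledProd γ (vals f e r m ρ) = (r / γ) ^ (queue ρ).length := by
  rw [vals, List.drop_of_length_le hm]
  simp [scaledProd]

/-- The codes along which all values at the nodes waiting after `m` digits are at some time at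
least `γ` have a measure that decreases exponentially in `m`. Before `m` digits are read, each
branching adds a node to the queue, and each waiting node contributes a factor `r / γ < 1`. -/
theorem mu_openOf_vals_le {d : MassFunction} {b r γ : ℝ} (hb : 0 ≤ b) (hb2 : 2 * b ≤ 1)
    (hr : 0 ≤ r) (hfix : 2 * b * avoid b r 1 + (1 - 2 * b) * avoid b r r ≤ r)
    (hγ : 0 < γ) (hrγ : r ≤ γ) (hγ1 : γ ≤ 1) {N m : ℕ} (hd : EventuallyBalanced d b N)
    (hNm : N ≤ m) :
    mu d (openOf {ρ | m ≤ ρ.length ∧ ∀ v ∈ vals (avoid b) 1 r m ρ, γ ≤ v}) ≤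
      ENNReal.ofReal ((2 * b + (1 - 2 * b) * (r / γ)) ^ (m - N)) := by
  set η := r / γ with hη
  set θ := 2 * b + (1 - 2 * b) * η with hθ
  have hη0 : 0 ≤ η := div_nonneg hr hγ.le
  have hη1 : η ≤ 1 := (div_le_one hγ).2 hrγ
  have hb3 : 0 ≤ 1 - 2 * b := by linarith
  have hθ0 : 0 ≤ θ := by positivity
  have hr1 := hrγ.trans hγ1
  let M : List (Fin 3) → ℝ := fun ρ =>
    θ ^ (m - max N ρ.length) * scaledProd γ (vals (avoid b) 1 r m ρ)
  have hM0 : ∀ ρ, 0 ≤ M ρ := fun ρ => mul_nonneg (pow_nonneg hθ0 _)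
    (scaledProd_nonneg hγ fun x hx => (vals_mem hb hb2 hr hr1 m ρ x hx).1)
  have hMnil : M [] ≤ θ ^ (m - N) := by
    have h := scaledProd_vals_of_length_le (f := avoid b) (e := 1) (r := r) (γ := γ)
      (m := m) (ρ := []) (Nat.zero_le m)
    simp only [M, h, List.length_nil, Nat.zero_le, sup_of_le_left]
    exact mul_le_of_le_one_right (pow_nonneg hθ0 _) (pow_le_one₀ hη0 hη1)
  refine (mu_openOf_le d M hM0 _ (fun ρ => ?_) (fun ρ hρ => ?_)).trans
    (ENNReal.ofReal_le_ofReal hMnil)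
  · have hs := d.split ρ
    rw [Fin.sum_univ_three] at hs
    have hd2 := d.nonneg (ρ ++ [2])
    rcases le_or_gt m ρ.length with hm | hm
    · have h := nextSum_scaledProd_vals_le hb hb2 hr hr1 hfix hγ hd ρ (hNm.trans hm) hm
      have e1 : m - max N ρ.length = 0 := by omega
      have e2 : m - max N (ρ.length + 1) = 0 := by omega
      simpa [M, nextSum, e1, e2] using h
    · have e : ∀ i : Fin 3, M (ρ ++ [i]) = θ ^ (m - max N (ρ.length + 1)) *
          η ^ ((queue ρ).length + if i = 2 then 1 else 0) := by
        intro i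
        simp only [M]
        rw [scaledProd_vals_of_length_le (by simpa using hm), length_queue_concat]
        simp [hη]
      have e3 : M ρ = θ ^ (m - max N ρ.length) * η ^ (queue ρ).length := by
        simp only [M]
        rw [scaledProd_vals_of_length_le hm.le]
      unfold nextSum
      rw [e, e, e, e3]
      simp only [Fin.reduceEq, if_false, if_true, add_zero, pow_succ]
      have hq : 0 ≤ η ^ (queue ρ).length := pow_nonneg hη0 _
      have hq' : 0 ≤ θ ^ (m - max N (ρ.length + 1)) := pow_nonneg hθ0 _
      rcases le_or_gt N ρ.length with hN | hN
      · rw [show m - max N ρ.length = (m - max N (ρ.length + 1)) + 1 by omega, pow_succ]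
        obtain ⟨hp, hpb⟩ := hd ρ hN
        rw [← hp] at hs ⊢
        have key : d (ρ ++ [0]) + d (ρ ++ [0]) + d (ρ ++ [2]) * η ≤ d ρ * θ := by
          rw [hs]
          rw [show d (ρ ++ [2]) = d ρ - 2 * d (ρ ++ [0]) by linarith, hθ]
          nlinarith [mul_nonneg (sub_nonneg.2 hpb) (sub_nonneg.2 hη1)]
        nlinarith [mul_nonneg (mul_nonneg hq hq') (sub_nonneg.2 key)]
      · rw [show m - max N ρ.length = m - max N (ρ.length + 1) by omega, hs]
        nlinarith [mul_nonneg (mul_nonneg hq hq') (mul_nonneg hd2 (sub_nonneg.2 hη1))]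
  · have e1 : m - max N ρ.length = 0 := by have := hρ.1; omega
    simp only [M, e1, pow_zero, one_mul]
    exact one_le_scaledProd hγ hρ.2

/-! ### Positive capacity -/

open Classical in
/-- The probability that a tree, grown from the node `k` with independent choices as in `avoid`
until each branch reaches an index of at least `l`, has none of its final nodes in `P`. -/
noncomputable def treeAvoid (b : ℝ) (P : Set ℕ) (l k : ℕ) : ℝ :=
  if l ≤ k then if k ∈ P then 0 else 1
  else avoid b (treeAvoid b P l (2 * k + 1)) (treeAvoid b P l (2 * k + 2))
termination_by l - k

section treeAvoid

variable {b : ℝ} {P : Set ℕ} {l : ℕ}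

theorem treeAvoid_of_lt {k : ℕ} (h : k < l) : treeAvoid b P l k =
    avoid b (treeAvoid b P l (2 * k + 1)) (treeAvoid b P l (2 * k + 2)) := by
  rw [treeAvoid, if_neg (not_le.2 h)]

theorem treeAvoid_of_le_of_mem {k : ℕ} (h : l ≤ k) (hk : k ∈ P) : treeAvoid b P l k = 0 := by
  rw [treeAvoid, if_pos h, if_pos hk]

theorem treeAvoid_of_le_of_notMem {k : ℕ} (h : l ≤ k) (hk : k ∉ P) : treeAvoid b P l k = 1 := by
  rw [treeAvoid, if_pos h, if_neg hk]

theorem treeAvoid_mem (hb : 0 ≤ b) (hb2 : 2 * b ≤ 1) (k : ℕ) :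
    0 ≤ treeAvoid b P l k ∧ treeAvoid b P l k ≤ 1 := by
  induction h : l - k using Nat.strong_induction_on generalizing k with
  | _ t ih =>
    rcases le_or_gt l k with hl | hl
    · by_cases hk : k ∈ P
      · simp [treeAvoid_of_le_of_mem hl hk]
      · simp [treeAvoid_of_le_of_notMem hl hk]
    · rw [treeAvoid_of_lt hl]
      have h1 := ih (l - (2 * k + 1)) (by omega) (2 * k + 1) rfl
      have h2 := ih (l - (2 * k + 2)) (by omega) (2 * k + 2) rfl
      exact ⟨avoid_nonneg hb hb2 h1.1 h2.1, avoid_le_one hb hb2 h1.1 h2.1 h1.2 h2.2⟩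

theorem treeAvoid_of_notMem (hP : IsTreeSet P) {k : ℕ} (hk : k ∉ P) : treeAvoid b P l k = 1 := by
  induction h : l - k using Nat.strong_induction_on generalizing k with
  | _ t ih =>
    rcases le_or_gt l k with hl | hl
    · exact treeAvoid_of_le_of_notMem hl hk
    · have hk' := mt (hP.2 k).2 hk
      push Not at hk'
      rw [treeAvoid_of_lt hl, ih (l - (2 * k + 1)) (by omega) hk'.1 rfl,
        ih (l - (2 * k + 2)) (by omega) hk'.2 rfl, avoid_one_one]

theorem treeAvoid_le_avoid (hb : 0 ≤ b) (hb2 : 2 * b ≤ 1) {k : ℕ} (hk : k ∈ P) {x y : ℝ}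
    (hx : treeAvoid b P l (2 * k + 1) ≤ x) (hy : treeAvoid b P l (2 * k + 2) ≤ y) :
    treeAvoid b P l k ≤ avoid b x y := by
  have h1 := (treeAvoid_mem (P := P) (l := l) hb hb2 (2 * k + 1)).1
  have h2 := (treeAvoid_mem (P := P) (l := l) hb hb2 (2 * k + 2)).1
  rcases le_or_gt l k with hl | hl
  · rw [treeAvoid_of_le_of_mem hl hk]
    exact avoid_nonneg hb hb2 (h1.trans hx) (h2.trans hy)
  · rw [treeAvoid_of_lt hl]
    exact avoid_mono hb hb2 h1 h2 hx hy

/-- The values computed backward along the code of a tree bound the avoidance probabilities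
from above, since an absent child and a leaf get values that are at least the true ones. -/
theorem forall₂_treeAvoid_le (hb : 0 ≤ b) (hb2 : 2 * b ≤ 1) {r : ℝ} (hr : 0 ≤ r)
    {x : ℕ → Fin 3} (hx : ∀ n, ∀ k ∈ queue (pre x n), k ∈ P) {j : ℕ} (hj : l ≤ j) (t : ℕ) :
    ∀ i, i + t = j → List.Forall₂ (fun v k => treeAvoid b P l k ≤ v)
      (vals (avoid b) 1 r i (pre x j)) (queue (pre x i)).reverse := by
  induction t with
  | zero =>
    intro i hi
    obtain rfl : i = j := hi
    rw [vals, List.drop_of_length_le (by simp), List.foldr_nil, List.forall₂_iff_get]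
    refine ⟨by simp, fun n h1 h2 => ?_⟩
    have hmem : (queue (pre x i)).reverse.get ⟨n, h2⟩ ∈ queue (pre x i) :=
      List.mem_reverse.1 (List.get_mem _ _)
    have hle := length_le_of_mem_queue _ _ hmem
    rw [pre_length] at hle
    rw [treeAvoid_of_le_of_mem (hj.trans hle) (hx _ _ hmem)]
    simpa using hr
  | succ t ih =>
    intro i hi
    have h := ih (i + 1) (by omega)
    have hdrop : (pre x j).drop i = x i :: (pre x j).drop (i + 1) := by
      rw [List.drop_eq_getElem_cons (by rw [pre_length]; omega)]
      simp [pre]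
    rw [vals, hdrop, List.foldr_cons]
    rw [← vals]
    generalize vals (avoid b) 1 r (i + 1) (pre x j) = v at h
    obtain ⟨q, hq⟩ := queue_eq (pre x i)
    set k := top (pre x i)
    have hk : k ∈ P := hx i k (by rw [hq]; simp)
    rw [pre_succ, queue_concat, hq, step, List.reverse_append] at h
    rw [hq, List.reverse_cons]
    have hone := fun k => (treeAvoid_mem (P := P) (l := l) hb hb2 k).2
    have h012 : x i = 0 ∨ x i = 1 ∨ x i = 2 := by
      generalize x i = a
      fin_cases a <;> simp
    rcases h012 with ha | ha | ha <;> rw [ha] at h ⊢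
    · simp only [children, if_true, List.reverse_singleton, List.singleton_append,
        List.forall₂_cons_right_iff] at h
      obtain ⟨y, v, hy, hv, rfl⟩ := h
      exact List.rel_append hv
        (.cons (treeAvoid_le_avoid hb hb2 hk hy (hone _)) .nil)
    · simp only [children, one_ne_zero, if_true, if_false, List.reverse_singleton,
        List.singleton_append, List.forall₂_cons_right_iff] at h
      obtain ⟨y, v, hy, hv, rfl⟩ := h
      refine List.rel_append hv (.cons ?_ .nil)
      rw [avoid_comm]
      exact treeAvoid_le_avoid hb hb2 hk (hone _) hy
    · simp only [children, Fin.reduceEq, if_false, List.reverse_cons, List.reverse_nil,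
        List.nil_append, List.cons_append, List.forall₂_cons_right_iff] at h
      obtain ⟨y, v, hy, ⟨z, v, hz, hv, rfl⟩, rfl⟩ := h
      exact List.rel_append hv (.cons (treeAvoid_le_avoid hb hb2 hk hz hy) .nil)

/-- The product of the avoidance probabilities over the queue. -/
noncomputable def queueAvoid (b : ℝ) (P : Set ℕ) (l : ℕ) (ρ : List (Fin 3)) : ℝ :=
  ((queue ρ).map (treeAvoid b P l)).prod

theorem queueAvoid_nonneg (hb : 0 ≤ b) (hb2 : 2 * b ≤ 1) (ρ : List (Fin 3)) :
    0 ≤ queueAvoid b P l ρ := by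
  refine List.prod_nonneg fun x hx => ?_
  obtain ⟨k, -, rfl⟩ := List.mem_map.1 hx
  exact (treeAvoid_mem hb hb2 k).1

theorem prod_le_one_of_forall {s : List ℝ} (hs : ∀ x ∈ s, 0 ≤ x ∧ x ≤ 1) : s.prod ≤ 1 := by
  induction s with
  | nil => simp
  | cons y s ih =>
    rw [List.prod_cons]
    exact mul_le_one₀ (hs y (by simp)).2
      (List.prod_nonneg fun z hz => (hs z (by simp [hz])).1) (ih fun z hz => hs z (by simp [hz]))

theorem prod_le_of_mem {s : List ℝ} (hs : ∀ x ∈ s, 0 ≤ x ∧ x ≤ 1) {x : ℝ} (hx : x ∈ s) :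
    s.prod ≤ x := by
  induction s with
  | nil => simp at hx
  | cons y s ih =>
    have hy := hs y (by simp)
    have hs' : ∀ z ∈ s, 0 ≤ z ∧ z ≤ 1 := fun z hz => hs z (by simp [hz])
    rw [List.prod_cons]
    rcases List.mem_cons.1 hx with rfl | hx
    · exact mul_le_of_le_one_right hy.1 (prod_le_one_of_forall hs')
    · exact (mul_le_of_le_one_left (List.prod_nonneg fun z hz => (hs' z hz).1) hy.2).trans
        (ih hs' hx)

theorem queueAvoid_le (hb : 0 ≤ b) (hb2 : 2 * b ≤ 1) {ρ : List (Fin 3)} {k : ℕ}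
    (hk : k ∈ queue ρ) : queueAvoid b P l ρ ≤ treeAvoid b P l k := by
  refine prod_le_of_mem (fun x hx => ?_) (List.mem_map_of_mem hk)
  obtain ⟨k, -, rfl⟩ := List.mem_map.1 hx
  exact treeAvoid_mem hb hb2 k

theorem nextSum_queueAvoid_le (hb : 0 ≤ b) (hb2 : 2 * b ≤ 1) {d : MassFunction} {N : ℕ}
    (hd : EventuallyBalanced d b N) {ρ : List (Fin 3)} (hN : N ≤ ρ.length) (hl : top ρ < l) :
    nextSum d (queueAvoid b P l) ρ ≤ d ρ * queueAvoid b P l ρ := by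
  obtain ⟨q, hq⟩ := queue_eq ρ
  obtain ⟨hp, hpb⟩ := hd ρ hN
  have hs := d.split ρ
  rw [Fin.sum_univ_three, ← hp] at hs
  have hQ : 0 ≤ (q.map (treeAvoid b P l)).prod := by
    refine List.prod_nonneg fun x hx => ?_
    obtain ⟨k, -, rfl⟩ := List.mem_map.1 hx
    exact (treeAvoid_mem hb hb2 k).1
  have h1 := treeAvoid_mem (P := P) (l := l) hb hb2 (2 * top ρ + 1)
  have h2 := treeAvoid_mem (P := P) (l := l) hb hb2 (2 * top ρ + 2)
  have key := weighted_le_avoid h1.1 h2.1 h1.2 h2.2 hpb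
  rw [← treeAvoid_of_lt hl] at key
  unfold nextSum queueAvoid
  rw [queue_concat, queue_concat, queue_concat, hq, ← hp,
    show d (ρ ++ [2]) = d ρ - 2 * d (ρ ++ [0]) by linarith]
  simp only [step, children, List.map_append, List.prod_append, if_true, if_false, one_ne_zero,
    Fin.reduceEq, List.map_cons, List.map_nil, List.prod_cons, List.prod_nil, mul_one]
  nlinarith [mul_nonneg hQ (sub_nonneg.2 key)]

end treeAvoid

/-- Suppose that some node waiting after `σ` has avoidance probability at most `γ`, at any depth.
Then, given the initial segment `σ` of its code, a random closed set misses the tree `P` with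
probability at most `γ`. -/
theorem mu_avoid_le {d : MassFunction} {b γ : ℝ} (hb : 0 ≤ b) (hb2 : 2 * b ≤ 1) {N : ℕ}
    (hd : EventuallyBalanced d b N) {P : Set ℕ} (hP : IsTreeSet P) {σ : List (Fin 3)}
    (hN : N ≤ σ.length) (hσ : ∀ l, ∃ k ∈ queue σ, treeAvoid b P l k ≤ γ) :
    mu d (cyl σ ∩ {x | ∃ n, ∀ k ∈ queue (pre x (σ.length + n)), k ∉ P}) ≤
      ENNReal.ofReal (d σ * γ) := by
  let S : Set (List (Fin 3)) := {ρ | ∀ k ∈ queue ρ, k ∉ P}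
  have hmono : Monotone fun n : ℕ =>
      ⋃ δ ∈ {δ : List (Fin 3) | δ.length ≤ n ∧ σ ++ δ ∈ S}, (cyl (σ ++ δ) : Set (ℕ → Fin 3)) :=
    fun m n hmn => Set.biUnion_mono (fun δ hδ => ⟨hδ.1.trans hmn, hδ.2⟩) fun _ _ => subset_rfl
  have hsub : cyl σ ∩ {x | ∃ n, ∀ k ∈ queue (pre x (σ.length + n)), k ∉ P} ⊆
      ⋃ n : ℕ, ⋃ δ ∈ {δ : List (Fin 3) | δ.length ≤ n ∧ σ ++ δ ∈ S}, cyl (σ ++ δ) := by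
    rintro x ⟨hx, n, hn⟩
    have h : pre x (σ.length + n) = σ ++ (pre x (σ.length + n)).drop σ.length := by
      conv_lhs => rw [pre_eq_append x (Nat.le_add_right σ.length n), (mem_cyl_iff x σ).1 hx]
    refine Set.mem_iUnion.2 ⟨n, Set.mem_iUnion₂.2
      ⟨(pre x (σ.length + n)).drop σ.length, ⟨by simp, ?_⟩, ?_⟩⟩
    · rw [← h]; exact hn
    · rw [← h]; exact mem_cyl_pre x _
  refine (measure_mono hsub).trans ?_
  rw [hmono.measure_iUnion]
  refine iSup_le fun n => ?_
  -- All nodes explored along codes of length at most `σ.length + n` have an index below this.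
  obtain ⟨k, hk, hkγ⟩ := hσ (2 ^ (σ.length + n + 1))
  refine (mu_reach_le_of_steps d (queueAvoid b P (2 ^ (σ.length + n + 1)))
    (queueAvoid_nonneg hb hb2) S n σ (fun δ hδ => ?_) (fun δ hδ => ?_)).trans
    (ENNReal.ofReal_le_ofReal
      (mul_le_mul_of_nonneg_left ((queueAvoid_le hb hb2 hk).trans hkγ) (d.nonneg σ)))
  · refine nextSum_queueAvoid_le hb hb2 hd (by rw [List.length_append]; omega) ?_
    have h1 := queue_mem_le _ _ (top_mem (σ ++ δ))
    have h2 : 2 ^ ((σ ++ δ).length + 1) ≤ 2 ^ (σ.length + n + 1) :=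
      Nat.pow_le_pow_right (by norm_num) (by rw [List.length_append]; omega)
    omega
  · refine le_of_eq (List.prod_eq_one fun x hx => ?_).symm
    obtain ⟨k, hk, rfl⟩ := List.mem_map.1 hx
    exact treeAvoid_of_notMem hP (hδ k hk)

/-- If along the code of `R` some value computed backward for the nodes waiting after `m` digits
always stays below `γ < 1`, then `R` has positive capacity. -/
theorem capacity_pos {d : MassFunction} {b r γ : ℝ} (hb : 0 ≤ b) (hb2 : 2 * b ≤ 1)
    (hr : 0 ≤ r) (hγ : γ < 1) {N m : ℕ} (hd : EventuallyBalanced d b N) (hNm : N ≤ m)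
    {R : ClosedSets} (hpos : 0 < d (pre (code R) m))
    (hR : ∀ j, m ≤ j → ∃ v ∈ vals (avoid b) 1 r m (pre (code R) j), v < γ) :
    0 < capacity d R := by
  set σ := pre (code R) m with hσ
  have hσl : σ.length = m := pre_length _ _
  have hP := isTreeSet_treeSet R
  have hk : ∀ l, ∃ k ∈ queue σ, treeAvoid b (treeSet R) l k ≤ γ := by
    intro l
    obtain ⟨v, hv, hvγ⟩ := hR (m + l) (by omega)
    have h2 := forall₂_treeAvoid_le hb hb2 hr (fun n => (mem_queue_code R n).1)
      (show l ≤ m + l by omega) l m rfl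
    obtain ⟨n, hn, rfl⟩ := List.getElem_of_mem hv
    have hn' : n < (queue σ).reverse.length := h2.length_eq ▸ hn
    refine ⟨(queue σ).reverse[n], List.mem_reverse.1 (List.getElem_mem hn'), ?_⟩
    exact (List.Forall₂.get h2 hn hn').trans hvγ.le
  have hle := mu_avoid_le hb hb2 hd hP (by rw [hσl]; exact hNm) hk
  set bad := {x : ℕ → Fin 3 | ∃ n, ∀ k ∈ queue (pre x (σ.length + n)), k ∉ treeSet R}
  rw [capacity, muStar_apply, pos_iff_ne_zero]
  intro h0
  have hcov : cyl σ ⊆ (cyl σ ∩ bad) ∪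
      code '' {K | ((K : Set (ℕ → Bool)) ∩ (R : Set (ℕ → Bool))).Nonempty} := by
    intro x hx
    by_cases hxb : x ∈ bad
    · exact Or.inl ⟨hx, hxb⟩
    · right
      obtain ⟨K, rfl⟩ := code_surjective x
      refine ⟨K, inter_nonempty_of_treeSet K R fun n => ?_, rfl⟩
      simp only [bad, Set.mem_ofPred_eq] at hxb
      push Not at hxb
      obtain ⟨k, hk, hkR⟩ := hxb n
      refine ⟨k, ?_, (mem_queue_code K _).1 k hk, hkR⟩
      have := length_le_of_mem_queue _ _ hk
      rw [pre_length] at this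
      omega
  have h1 := (measure_mono (μ := mu d) hcov).trans (measure_union_le _ _)
  rw [h0, add_zero, mu_cyl] at h1
  have h2 := h1.trans hle
  rw [ENNReal.ofReal_le_ofReal_iff'] at h2
  rcases h2 with h2 | h2
  · nlinarith
  · linarith

/-! ### Effectivity of the test -/

section Primrec

variable {α β : Type*} [Primcodable α] [Primcodable β]

theorem primrec_back {f : α → α → α} (hf : Primrec₂ f) (e : α) : Primrec₂ (back f e) := by
  have hi : PrimrecPred fun p : Fin 3 × List α => p.1 = 2 :=
    Primrec.eq.comp Primrec.fst (Primrec.const 2)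
  have hsnd : Primrec fun p : Fin 3 × List α => p.2 := Primrec.snd
  have h2 : Primrec fun p : Fin 3 × List α =>
      (p.2.casesOn p.2 fun x l => l.casesOn p.2 fun y l => l ++ [f y x] : List α) := by
    refine Primrec.list_casesOn (h := fun p q => q.2.casesOn p.2 fun y l => l ++ [f y q.1])
      hsnd hsnd ?_
    refine Primrec.list_casesOn (f := fun p : (Fin 3 × List α) × (α × List α) => p.2.2)
      (g := fun p => p.1.2) (h := fun p q => q.2 ++ [f q.1 p.2.1]) ?_ ?_ ?_
    · exact Primrec.snd.comp Primrec.snd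
    · exact Primrec.snd.comp Primrec.fst
    · refine Primrec.list_concat.comp (Primrec.snd.comp Primrec.snd) (hf.comp ?_ ?_)
      · exact Primrec.fst.comp Primrec.snd
      · exact Primrec.fst.comp (Primrec.snd.comp Primrec.fst)
  have h1 : Primrec fun p : Fin 3 × List α =>
      (p.2.casesOn [] fun x l => l ++ [f x e] : List α) := by
    refine Primrec.list_casesOn (h := fun p q => q.2 ++ [f q.1 e]) hsnd (Primrec.const []) ?_
    exact Primrec.list_concat.comp (Primrec.snd.comp Primrec.snd)
      (hf.comp (Primrec.fst.comp Primrec.snd) (Primrec.const e))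
  refine (Primrec.ite hi h2 h1).of_eq fun p => ?_
  rcases p with ⟨i, l⟩
  unfold back
  rcases l with - | ⟨x, - | ⟨y, l⟩⟩ <;> rfl

theorem length_queue_eq_foldl (ρ : List (Fin 3)) :
    (queue ρ).length = ρ.foldl (fun n i => if i = 2 then n + 1 else n) 1 := by
  induction ρ using List.reverseRecOn with
  | nil => rfl
  | append_singleton ρ i ih =>
    rw [length_queue_concat, ih, List.foldl_append, List.foldl_cons, List.foldl_nil]
    split <;> rfl

theorem primrec_length_queue : Primrec fun ρ : List (Fin 3) => (queue ρ).length := by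
  have h : Primrec fun ρ : List (Fin 3) =>
      ρ.foldl (fun n i => if i = 2 then n + 1 else n) 1 := by
    refine Primrec.list_foldl (h := fun _ p => if p.2 = 2 then p.1 + 1 else p.1) Primrec.id
      (Primrec.const 1) ?_
    refine Primrec.ite (Primrec.eq.comp (Primrec.snd.comp Primrec.snd) (Primrec.const 2)) ?_ ?_
    · exact Primrec.succ.comp (Primrec.fst.comp Primrec.snd)
    · exact Primrec.fst.comp Primrec.snd
  exact h.of_eq fun ρ => (length_queue_eq_foldl ρ).symm

theorem primrec_vals {f : α → α → α} (hf : Primrec₂ f) (e r : α) : Primrec₂ (vals f e r) := by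
  have hrep : Primrec fun p : ℕ × List (Fin 3) => List.replicate (queue p.2).length r := by
    have h : Primrec fun p : ℕ × List (Fin 3) =>
        (List.range (queue p.2).length).map fun _ => r :=
      Primrec.list_map (Primrec.list_range.comp (primrec_length_queue.comp Primrec.snd))
        (Primrec.const r)
    exact h.of_eq fun p => by simp [List.map_const']
  refine Primrec.list_foldr (h := fun _ q => back f e q.1 q.2)
    (Primrec.list_drop.comp Primrec.fst Primrec.snd) hrep ?_
  exact (primrec_back hf e).comp (Primrec.fst.comp Primrec.snd) (Primrec.snd.comp Primrec.snd)

end Primrec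

/-- The pair `(n, m)` stands for the fraction `n / (m + 1)`. -/
noncomputable def toReal (p : ℕ × ℕ) : ℝ := p.1 / (p.2 + 1)

theorem exists_toReal_eq {q : ℚ} (hq : 0 ≤ q) : ∃ p : ℕ × ℕ, toReal p = q := by
  refine ⟨(q.num.toNat, q.den - 1), ?_⟩
  have h1 : ((q.den - 1 : ℕ) : ℝ) + 1 = q.den := by
    rw [Nat.cast_sub q.pos]; simp
  have h2 : ((q.num.toNat : ℕ) : ℝ) = (q.num : ℝ) := by
    exact_mod_cast Int.toNat_of_nonneg (Rat.num_nonneg.2 hq)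
  rw [toReal, h1, h2]
  exact (Rat.cast_def q).symm

/-- The function `avoid` on fractions. -/
def avoidFrac (c p q : ℕ × ℕ) : ℕ × ℕ :=
  (c.1 * p.1 * (q.2 + 1) + c.1 * q.1 * (p.2 + 1) + (c.2 + 1 - 2 * c.1) * p.1 * q.1,
    (c.2 + 1) * (p.2 + 1) * (q.2 + 1) - 1)

theorem toReal_avoidFrac {c : ℕ × ℕ} (hc : 2 * toReal c ≤ 1) (p q : ℕ × ℕ) :
    toReal (avoidFrac c p q) = avoid (toReal c) (toReal p) (toReal q) := by
  have hc' : 2 * c.1 ≤ c.2 + 1 := by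
    rw [toReal, ← mul_div_assoc, div_le_one (by positivity)] at hc
    exact_mod_cast hc
  have h1 : 1 ≤ (c.2 + 1) * (p.2 + 1) * (q.2 + 1) := Nat.succ_le_of_lt (by positivity)
  simp only [toReal, avoidFrac, avoid]
  push_cast [Nat.cast_sub h1, Nat.cast_sub hc']
  have hc0 : (c.2 : ℝ) + 1 ≠ 0 := by positivity
  have hp0 : (p.2 : ℝ) + 1 ≠ 0 := by positivity
  have hq0 : (q.2 : ℝ) + 1 ≠ 0 := by positivity
  rw [sub_add_cancel]
  field_simp

theorem primrec_avoidFrac (c : ℕ × ℕ) : Primrec₂ (avoidFrac c) := by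
  have hp1 : Primrec fun z : (ℕ × ℕ) × (ℕ × ℕ) => z.1.1 := Primrec.fst.comp Primrec.fst
  have hp2 : Primrec fun z : (ℕ × ℕ) × (ℕ × ℕ) => z.1.2 + 1 :=
    Primrec.succ.comp (Primrec.snd.comp Primrec.fst)
  have hq1 : Primrec fun z : (ℕ × ℕ) × (ℕ × ℕ) => z.2.1 := Primrec.fst.comp Primrec.snd
  have hq2 : Primrec fun z : (ℕ × ℕ) × (ℕ × ℕ) => z.2.2 + 1 :=
    Primrec.succ.comp (Primrec.snd.comp Primrec.snd)
  have hc : ∀ n : ℕ, Primrec fun _ : (ℕ × ℕ) × (ℕ × ℕ) => n := Primrec.const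
  have mul := Primrec.nat_mul
  have add := Primrec.nat_add
  exact Primrec.pair
    (add.comp (add.comp (mul.comp (mul.comp (hc _) hp1) hq2) (mul.comp (mul.comp (hc _) hq1) hp2))
      (mul.comp (mul.comp (hc _) hp1) hq1))
    (Primrec.nat_sub.comp (mul.comp (mul.comp (hc _) hp2) hq2) (hc 1))

/-- The `k`-th set of the test: the strings along which the values at the nodes waiting after
`N + a * k` digits have all become at least `g`. -/
def testSet (c r g : ℕ × ℕ) (N a k : ℕ) : Set (List (Fin 3)) :=
  {ρ | N + a * k ≤ ρ.length ∧
    ∀ v ∈ vals (avoidFrac c) (1, 0) r (N + a * k) ρ, g.1 * (v.2 + 1) ≤ v.1 * (g.2 + 1)}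

theorem rePred_testSet (c r g : ℕ × ℕ) (N a : ℕ) :
    REPred fun p : ℕ × List (Fin 3) => p.2 ∈ testSet c r g N a p.1 := by
  have hm : Primrec fun p : ℕ × List (Fin 3) => N + a * p.1 :=
    Primrec.nat_add.comp (Primrec.const N) (Primrec.nat_mul.comp (Primrec.const a) Primrec.fst)
  have h1 : PrimrecPred fun p : ℕ × List (Fin 3) => N + a * p.1 ≤ p.2.length :=
    Primrec.nat_le.comp hm (Primrec.list_length.comp Primrec.snd)
  have hv : PrimrecPred fun v : ℕ × ℕ => g.1 * (v.2 + 1) ≤ v.1 * (g.2 + 1) :=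
    Primrec.nat_le.comp
      (Primrec.nat_mul.comp (Primrec.const _) (Primrec.succ.comp Primrec.snd))
      (Primrec.nat_mul.comp Primrec.fst (Primrec.const _))
  have h2 : PrimrecPred fun p : ℕ × List (Fin 3) =>
      ∀ v ∈ vals (avoidFrac c) (1, 0) r (N + a * p.1) p.2, g.1 * (v.2 + 1) ≤ v.1 * (g.2 + 1) :=
    hv.forall_mem_list.comp ((primrec_vals (primrec_avoidFrac c) (1, 0) r).comp hm Primrec.snd)
  exact (h1.and h2).computablePred.to_re

theorem testSet_eq {c : ℕ × ℕ} (hc : 2 * toReal c ≤ 1) (r g : ℕ × ℕ) (N a k : ℕ) :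
    testSet c r g N a k = {ρ | N + a * k ≤ ρ.length ∧
      ∀ v ∈ vals (avoid (toReal c)) 1 (toReal r) (N + a * k) ρ, toReal g ≤ v} := by
  ext ρ
  have h := map_vals (φ := toReal) (r := r) (toReal_avoidFrac hc) (e := (1, 0)) (e' := 1)
    (by simp [toReal]) rfl (N + a * k) ρ
  simp only [testSet, Set.mem_ofPred_eq, ← h, List.forall_mem_map]
  refine and_congr_right fun _ => forall₂_congr fun v _ => ?_
  rw [toReal, toReal, div_le_div_iff₀ (by positivity) (by positivity)]
  exact_mod_cast Iff.rfl

/-- There is a single Martin-Löf test such that every closed set outside of it, whose code does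
not start with a string of measure zero, has positive capacity. -/
theorem exists_test {b : ℝ} (hb : b < 1 - √2 / 2) (d : MassFunction)
    (hd : ∃ N : ℕ, ∀ σ : List (Fin 3), N ≤ σ.length →
      d (σ ++ [0]) = d (σ ++ [1]) ∧ d (σ ++ [0]) ≤ b * d σ) :
    ∃ W, IsMLTest (mu d) W ∧ ∀ R : ClosedSets, code R ∉ ⋂ n, openOf (W n) →
      (∀ n, 0 < d (pre (code R) n)) → 0 < capacity d R := by
  obtain ⟨c, r, hbc, hc0, hc2, hr0, hr1, hfix⟩ := exists_parameters hb
  obtain ⟨g, hrg, hg1⟩ := exists_between hr1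
  obtain ⟨N, hN⟩ := hd
  have hdc : EventuallyBalanced d c N := fun σ hσ =>
    ⟨(hN σ hσ).1, (hN σ hσ).2.trans (mul_le_mul_of_nonneg_right hbc.le (d.nonneg σ))⟩
  have hc0' : (0 : ℝ) ≤ c := by exact_mod_cast hc0.le
  have hc2' : 2 * (c : ℝ) < 1 := by exact_mod_cast hc2
  have hr0' : (0 : ℝ) < r := by exact_mod_cast hr0
  have hrg' : (r : ℝ) < g := by exact_mod_cast hrg
  have hg1' : (g : ℝ) < 1 := by exact_mod_cast hg1
  have hg0' : (0 : ℝ) < g := hr0'.trans hrg'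
  obtain ⟨c', hc'⟩ := exists_toReal_eq hc0.le
  obtain ⟨r', hr'⟩ := exists_toReal_eq hr0.le
  obtain ⟨g', hg'⟩ := exists_toReal_eq (hr0.trans hrg).le
  set θ : ℝ := 2 * c + (1 - 2 * c) * (r / g) with hθ
  have hη : (r : ℝ) / g < 1 := (div_lt_one hg0').2 hrg'
  have hη0 : 0 < (r : ℝ) / g := div_pos hr0' hg0'
  have hθ0 : 0 ≤ θ := by
    have : 0 ≤ 1 - 2 * (c : ℝ) := by linarith
    positivity
  have hθ1 : θ < 1 := by nlinarith
  obtain ⟨a, ha⟩ := exists_pow_lt_of_lt_one (show (0 : ℝ) < 2⁻¹ by norm_num) hθ1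
  have hW : ∀ k, testSet c' r' g' N a k = {ρ | N + a * k ≤ ρ.length ∧
      ∀ v ∈ vals (avoid c) 1 r (N + a * k) ρ, (g : ℝ) ≤ v} := fun k => by
    rw [testSet_eq (by rw [hc']; exact hc2'.le), hc', hr', hg']
  refine ⟨testSet c' r' g' N a, ⟨rePred_testSet _ _ _ _ _, fun k => ?_⟩, fun R hR hpos => ?_⟩
  · rw [hW]
    refine (mu_openOf_vals_le hc0' hc2'.le hr0'.le hfix hg0' hrg'.le hg1'.le hdc
      (Nat.le_add_right N (a * k))).trans ?_
    rw [Nat.add_sub_cancel_left, pow_mul, ← hθ]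
    have h2 : (2⁻¹ : ℝ≥0∞) = ENNReal.ofReal 2⁻¹ := by
      rw [ENNReal.ofReal_inv_of_pos (by norm_num)]; simp
    rw [h2, ← ENNReal.ofReal_pow (by norm_num)]
    exact ENNReal.ofReal_le_ofReal (pow_le_pow_left₀ (pow_nonneg hθ0 a) ha.le k)
  · rw [Set.mem_iInter, not_forall] at hR
    obtain ⟨k, hk⟩ := hR
    rw [hW] at hk
    refine capacity_pos hc0' hc2'.le hr0'.le hg1' hdc (Nat.le_add_right N (a * k)) (hpos _)
      fun j hj => ?_
    by_contra! h
    exact hk (Set.mem_iUnion₂.2 ⟨pre (code R) j, ⟨by rw [pre_length]; exact hj, h⟩,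
      mem_cyl_pre _ j⟩)

theorem IsRandomClosedSet.pos {d : MassFunction} {R : ClosedSets} (hR : IsRandomClosedSet d R)
    (n : ℕ) : 0 < d (pre (code R) n) := by
  by_contra h
  have h0 : d (pre (code R) n) = 0 := le_antisymm (not_lt.1 h) (d.nonneg _)
  refine hR (fun _ => {pre (code R) n}) ⟨?_, fun k => ?_⟩ ?_
  · have : PrimrecPred fun p : ℕ × List (Fin 3) => p.2 = pre (code R) n :=
      Primrec.eq.comp Primrec.snd (Primrec.const _)
    exact this.computablePred.to_re
  · rw [openOf, Set.biUnion_singleton, mu_cyl, h0, ENNReal.ofReal_zero]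
    exact zero_le
  · simp only [openOf, Set.biUnion_singleton, Set.mem_iInter]
    exact fun _ => mem_cyl_pre _ n

theorem ae_pos (d : MassFunction) : ∀ᵐ x ∂(mu d), ∀ n, 0 < d (pre x n) := by
  rw [ae_all_iff]
  intro n
  have hsub : {x : ℕ → Fin 3 | ¬ 0 < d (pre x n)} ⊆
      ⋃ σ : {σ : List (Fin 3) // d σ = 0}, cyl σ.1 := fun x hx =>
    Set.mem_iUnion.2 ⟨⟨pre x n, le_antisymm (not_lt.1 hx) (d.nonneg _)⟩, mem_cyl_pre x n⟩
  refine measure_mono_null hsub (measure_iUnion_null fun σ => ?_)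
  rw [mu_cyl, σ.2, ENNReal.ofReal_zero]

theorem IsMLTest.measure_iInter {μ : Measure (ℕ → Fin 3)} {W : ℕ → Set (List (Fin 3))}
    (hW : IsMLTest μ W) : μ (⋂ n, openOf (W n)) = 0 := by
  refine le_antisymm (ge_of_tendsto' (ENNReal.tendsto_pow_atTop_nhds_zero_of_lt_one
    (r := 2⁻¹) ?_) fun n => ?_) zero_le
  · exact ENNReal.inv_lt_one.2 (by norm_num)
  · exact (measure_mono (Set.iInter_subset _ n)).trans (hW.measure_le n)

theorem ae_muStar_of_ae {d : MassFunction} {p : (ℕ → Fin 3) → Prop}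
    (h : ∀ᵐ x ∂(mu d), p x) : ∀ᵐ R ∂(muStar d), p (code R) := by
  rw [ae_iff, muStar_apply]
  refine measure_mono_null ?_ h
  rintro _ ⟨R, hR, rfl⟩
  exact hR

end RandomClosed

theorem theorem3p2 (b : ℝ) (hb : b < 1 - √2 / 2) (d : RandomClosed.MassFunction)
    (hd : ∃ N : ℕ, ∀ σ : List (Fin 3), N ≤ σ.length →
      d (σ ++ [0]) = d (σ ++ [1]) ∧ d (σ ++ [0]) ≤ b * d σ) :
    RandomClosed.muStar d {R | 0 < RandomClosed.capacity d R} = 1 ∧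
    (∀ᵐ R ∂(RandomClosed.muStar d), 0 < RandomClosed.capacity d R) ∧
    (∀ R : RandomClosed.ClosedSets, RandomClosed.IsRandomClosedSet d R →
      0 < RandomClosed.capacity d R) := by
  obtain ⟨W, hW, hcap⟩ := RandomClosed.exists_test hb d hd
  have hae : ∀ᵐ R ∂(RandomClosed.muStar d), 0 < RandomClosed.capacity d R := by
    have h1 : ∀ᵐ x ∂(RandomClosed.mu d), x ∉ ⋂ n, RandomClosed.openOf (W n) :=
      measure_eq_zero_iff_ae_notMem.1 hW.measure_iInter
    filter_upwards [RandomClosed.ae_muStar_of_ae h1,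
      RandomClosed.ae_muStar_of_ae (RandomClosed.ae_pos d)] with R h2 h3
    exact hcap R h2 h3
  refine ⟨?_, hae, fun R hR => hcap R (hR W hW) hR.pos⟩
  have huniv : {R | 0 < RandomClosed.capacity d R} =ᵐ[RandomClosed.muStar d] Set.univ :=
    Filter.eventuallyEq_univ.2 hae
  rw [measure_congr huniv, RandomClosed.muStar_apply, Set.image_univ,
    RandomClosed.code_surjective.range_eq, RandomClosed.mu_univ]
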